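/- Let $D\subset\mathbb R^d$, $d\ge 1$, be a nonempty bounded open set (for instance a bounded Lipschitz domain). Let $H_0^1(D)$ be the closure of $C_c^\infty(D)$ in $H^1(D)$ (for a bounded Lipschitz domain, the functions in $H^1(D)$ with zero trace), with norm $\|v\|_{H_0^1(D)}=\|\nabla v\|_{L^2(D)}$; let $H^{-1}(D)$ be its dual with the dual norm, and let $f\in H^{-1}(D)$. Let $c>0$, $0<\tau\le\beta$, and let $\boldsymbol\alpha=(\alpha_j)_{j\ge1}\in\ell^1(\mathbb N)$ be nonnegative, with $\|\boldsymbol\alpha\|_\infty<\beta^{-1}$ if $\tau=\beta$. Put $$U_{\boldsymbol\alpha,\tau}=\Big\{\boldsymbol y\in\mathbb R^{\mathbb N}:\sum_{j\ge1}\alpha_j|y_j|^\tau<\infty\Big\},\qquad a_{\min}(\boldsymbol y)=c\,\exp\Big(-\sum_{j\ge1}\alpha_j|y_j|^\tau\Big).$$ For a finitely supported multi-index $\boldsymbol\nu\in\mathbb N_0^{\mathbb N}$ write $|\boldsymbol\nu|=\sum_j\nu_j$, $\boldsymbol b^{\boldsymbol\nu}=\prod_j b_j^{\nu_j}$ (with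 $0^0=1$) and $\partial^{\boldsymbol\nu}=\prod_j\partial^{\nu_j}/\partial y_j^{\nu_j}$. Let $a:D\times U_{\boldsymbol\alpha,\tau}\to\mathbb R$ be such that $a(\cdot,\boldsymbol y)$ is measurable for every $\boldsymbol y\in U_{\boldsymbol\alpha,\tau}$ and, for every $\boldsymbol x\in D$, the function $\boldsymbol y\mapsto a(\boldsymbol x,\boldsymbol y)$ has mixed partial derivatives of all orders on $U_{\boldsymbol\alpha,\tau}$, independent of the order of differentiation. Assume that there are $\sigma\ge1$, $C>0$ and a sequence $\boldsymbol b=(b_j)_{j\ge1}$ of nonnegative numbers such that * (A1) $\displaystyle\Big\|\frac{\partial^{\boldsymbol\nu}a(\cdot,\boldsymbol y)}{a(\cdot,\boldsymbol y)}\Big\|_{L^\infty(D)}\le C(|\boldsymbol\nu|!)^\sigma\boldsymbol b^{\boldsymbol\nu}$ for all $\boldsymbol y\in U_{\boldsymbol\alpha,\tau}$ and all finitely supported multi-indices $\boldsymbol\nu$; * (A5) $a(\boldsymbol x,\boldsymbol y)\ge a_{\min}(\boldsymbol y)$ for all $\boldsymbol x\in D$ and $\boldsymbol y\in U_{\boldsymbol\alpha,\tau}$.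 Call $w\in H_0^1(D)$ a weak solution at $\boldsymbol y$ if, for all $v\in H_0^1(D)$, the integral on the left exists and $$\int_D a(\boldsymbol x,\boldsymbol y)\,\nabla w(\boldsymbol x)\cdot\nabla v(\boldsymbol x)\,\mathrm d\boldsymbol x=\langle f,v\rangle_{H^{-1}(D),H_0^1(D)}.$$ Then: 1. For every $\boldsymbol y\in U_{\boldsymbol\alpha,\tau}$ with $a(\cdot,\boldsymbol y)\in L^\infty(D)$ there is exactly one weak solution at $\boldsymbol y$. 2. If $u(\cdot,\boldsymbol y)\in H_0^1(D)$ is a weak solution at $\boldsymbol y$ for every $\boldsymbol y\in U_{\boldsymbol\alpha,\tau}$, then $\boldsymbol y\mapsto u(\cdot,\boldsymbol y)\in H_0^1(D)$ has mixed partial derivatives of all orders on $U_{\boldsymbol\alpha,\tau}$ (limits of difference quotients in the norm of $H_0^1(D)$), independent of the order of differentiation, and is Gevrey regular with the same parameter $\sigma$: for all finitely supported $\boldsymbol\nu\ne\boldsymbol 0$ and all $\boldsymbol y\in U_{\boldsymbol\alpha,\tau}$, $$\|\partial^{\boldsymbol\nu}u(\cdot,\boldsymbol y)\|_{H_0^1(D)}\le\frac{\|f\|_{H^{-1}(D)}}{a_{\min}(\boldsymbol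 y)}\,C(C+1)^{|\boldsymbol\nu|-1}(|\boldsymbol\nu|!)^\sigma\,\boldsymbol b^{\boldsymbol\nu},$$ where $C$ is the constant in (A1). -/

import Mathlib

open MeasureTheory Set Filter
open scoped ContDiff

noncomputable section

/-! ### The spatial domain and the space `H¹₀(D)` -/

/-- A nonempty bounded open set `D ⊆ ℝᵈ`, `d ≥ 1`. -/
structure BoundedOpen (d : ℕ) where
  carrier : Set (EuclideanSpace ℝ (Fin d))
  dim_pos : 0 < d
  isOpen : IsOpen carrier
  nonempty : carrier.Nonempty
  isBounded : Bornology.IsBounded carrier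

namespace BoundedOpen

variable {d : ℕ} (D : BoundedOpen d)

/-- Lebesgue measure on `D`. -/
abbrev vol : Measure (EuclideanSpace ℝ (Fin d)) := volume.restrict D.carrier

/-- `φ ∈ C_c^∞(D)`, as a function on all of `ℝᵈ`. -/
structure IsTestFunction (φ : EuclideanSpace ℝ (Fin d) → ℝ) : Prop where
  smooth : ContDiff ℝ ∞ φ
  compact : HasCompactSupport φ
  tsupport_subset : tsupport φ ⊆ D.carrier

/-- The product `L²(D) × L²(D; ℝᵈ)`, in which a function `v` with weak gradient `∇v` is
recorded as the pair `(v, ∇v)`. The topology is that of the `H¹(D)` norm. -/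
abbrev PairSpace : Type :=
  Lp ℝ 2 D.vol × Lp (EuclideanSpace ℝ (Fin d)) 2 D.vol

/-- The pairs `(φ, ∇φ)` with `φ ∈ C_c^∞(D)`. -/
def testPairs : Submodule ℝ D.PairSpace where
  carrier := {p | ∃ φ, D.IsTestFunction φ ∧ p.1 =ᵐ[D.vol] φ ∧ p.2 =ᵐ[D.vol] gradient φ}
  zero_mem' := by
    refine ⟨0, ⟨contDiff_const, HasCompactSupport.zero, by simp⟩, Lp.coeFn_zero _ _ _, ?_⟩
    have h : gradient (0 : EuclideanSpace ℝ (Fin d) → ℝ) = 0 := by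
      funext x
      exact gradient_const x 0
    rw [h]
    exact Lp.coeFn_zero _ _ _
  add_mem' := by
    rintro p q ⟨φ, hφ, h1, h2⟩ ⟨ψ, hψ, h3, h4⟩
    refine ⟨φ + ψ, ⟨hφ.smooth.add hψ.smooth, hφ.compact.add hψ.compact, ?_⟩, ?_, ?_⟩
    · exact (tsupport_add φ ψ).trans (union_subset hφ.tsupport_subset hψ.tsupport_subset)
    · filter_upwards [Lp.coeFn_add p.1 q.1, h1, h3] with x hx hx1 hx3
      change (p.1 + q.1 : Lp ℝ 2 D.vol) x = φ x + ψ x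
      rw [hx, Pi.add_apply, hx1, hx3]
    · filter_upwards [Lp.coeFn_add p.2 q.2, h2, h4] with x hx hx2 hx4
      have e1 : DifferentiableAt ℝ φ x := hφ.smooth.differentiable (by simp) x
      have e2 : DifferentiableAt ℝ ψ x := hψ.smooth.differentiable (by simp) x
      simp only [Prod.snd_add, hx, Pi.add_apply, hx2, hx4, gradient, fderiv_add e1 e2, map_add]
  smul_mem' := by
    rintro c p ⟨φ, hφ, h1, h2⟩
    refine ⟨c • φ, ⟨contDiff_const.smul hφ.smooth, ?_, ?_⟩, ?_, ?_⟩
    · exact hφ.compact.smul_left (f := fun _ => c)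
    · exact (tsupport_smul_subset_right (fun _ => c) φ).trans hφ.tsupport_subset
    · filter_upwards [Lp.coeFn_smul c p.1, h1] with x hx hx1
      simp [hx, hx1]
    · filter_upwards [Lp.coeFn_smul c p.2, h2] with x hx hx2
      have e1 : DifferentiableAt ℝ φ x := hφ.smooth.differentiable (by simp) x
      simp only [Prod.smul_snd, hx, Pi.smul_apply, hx2, gradient, fderiv_const_smul e1, map_smul]

/-- Integration by parts for `φ²` against a coordinate function, followed by Young's inequality. -/
theorem test_poincare {R : ℝ} (hR : ∀ x ∈ D.carrier, ‖x‖ ≤ R)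
    {φ : EuclideanSpace ℝ (Fin d) → ℝ} (hφ : D.IsTestFunction φ) :
    ∫ x, φ x ^ 2 ∂D.vol ≤ 4 * R ^ 2 * ∫ x, ‖gradient φ x‖ ^ 2 ∂D.vol := by
  obtain ⟨i⟩ : Nonempty (Fin d) := ⟨⟨0, D.dim_pos⟩⟩
  obtain ⟨e, hei, hen⟩ : ∃ e : EuclideanSpace ℝ (Fin d), e i = 1 ∧ ‖e‖ = 1 :=
    ⟨EuclideanSpace.single i (1 : ℝ), by simp, by simp⟩
  have hdiff : Differentiable ℝ φ := hφ.smooth.differentiable (by simp)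
  have hcont : Continuous φ := hφ.smooth.continuous
  have hfd : Continuous (fderiv ℝ φ) := hφ.smooth.continuous_fderiv (by simp)
  have hfdc : HasCompactSupport (fderiv ℝ φ) := hφ.compact.fderiv (𝕜 := ℝ)
  have hgr : Continuous (gradient φ) :=
    (InnerProductSpace.toDual ℝ (EuclideanSpace ℝ (Fin d))).symm.continuous.comp hfd
  have hgrc : HasCompactSupport (gradient φ) :=
    hfdc.comp_left (g := (InnerProductSpace.toDual ℝ (EuclideanSpace ℝ (Fin d))).symm) (map_zero _)
  have hl : ∀ x : EuclideanSpace ℝ (Fin d), HasFDerivAt (fun x : EuclideanSpace ℝ (Fin d) => x i)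
      (EuclideanSpace.proj i : EuclideanSpace ℝ (Fin d) →L[ℝ] ℝ) x := fun x =>
    (EuclideanSpace.proj i : EuclideanSpace ℝ (Fin d) →L[ℝ] ℝ).hasFDerivAt
  have hl1 : ∀ x : EuclideanSpace ℝ (Fin d),
      fderiv ℝ (fun x : EuclideanSpace ℝ (Fin d) => x i) x e = 1 := by
    intro x
    rw [(hl x).fderiv]
    simpa using hei
  have hsq : ∀ x, fderiv ℝ (fun x => φ x ^ 2) x e = 2 * φ x * fderiv ℝ φ x e := by
    intro x
    have h := ((hdiff x).hasFDerivAt.pow 2).fderiv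
    rw [h]
    simp
  have hi : Continuous fun x : EuclideanSpace ℝ (Fin d) => x i :=
    (EuclideanSpace.proj i : EuclideanSpace ℝ (Fin d) →L[ℝ] ℝ).continuous
  have hfe : Continuous fun x => fderiv ℝ φ x e := hfd.clm_apply continuous_const
  have csq : HasCompactSupport fun x => φ x ^ 2 := by
    simp only [sq]
    exact hφ.compact.mul_left (f := φ)
  have isq : Integrable (fun x => φ x ^ 2) :=
    (hcont.pow 2).integrable_of_hasCompactSupport csq
  have cgr : HasCompactSupport fun x => ‖gradient φ x‖ ^ 2 := by
    simp only [sq]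
    exact hgrc.norm.mul_left (f := fun x => ‖gradient φ x‖)
  have igr : Integrable (fun x => ‖gradient φ x‖ ^ 2) :=
    (hgr.norm.pow 2).integrable_of_hasCompactSupport cgr
  have key : ∫ x, φ x ^ 2 = - ∫ x, x i * (2 * φ x * fderiv ℝ φ x e) := by
    have h := integral_mul_fderiv_eq_neg_fderiv_mul_of_integrable
      (μ := (volume : Measure (EuclideanSpace ℝ (Fin d)))) (𝕜 := ℝ) (v := e)
      (f := fun x : EuclideanSpace ℝ (Fin d) => x i) (g := fun x => φ x ^ 2) ?_ ?_ ?_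
      (fun x _ => (hl x).differentiableAt) (fun x _ => (hdiff x).pow 2)
    · simp only [hl1, hsq, one_mul] at h
      linarith
    · simpa only [hl1, one_mul] using isq
    · simp only [hsq]
      exact (hi.mul ((continuous_const.mul hcont).mul hfe)).integrable_of_hasCompactSupport
        ((hφ.compact.mul_left (f := fun _ => (2 : ℝ))).mul_right.mul_left)
    · exact (hi.mul (hcont.pow 2)).integrable_of_hasCompactSupport csq.mul_left
  have hz : ∀ x, x ∉ D.carrier → φ x = 0 := fun x hx =>
    image_eq_zero_of_notMem_tsupport fun h => hx (hφ.tsupport_subset h)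
  have hgz : ∀ x, x ∉ D.carrier → gradient φ x = 0 := by
    intro x hx
    have h : fderiv ℝ φ x = 0 := image_eq_zero_of_notMem_tsupport
      fun h => hx (hφ.tsupport_subset (tsupport_fderiv_subset ℝ h))
    simp [gradient, h]
  have r1 : ∫ x, φ x ^ 2 ∂D.vol = ∫ x, φ x ^ 2 :=
    setIntegral_eq_integral_of_forall_compl_eq_zero fun x hx => by simp [hz x hx]
  have r2 : ∫ x, ‖gradient φ x‖ ^ 2 ∂D.vol = ∫ x, ‖gradient φ x‖ ^ 2 :=
    setIntegral_eq_integral_of_forall_compl_eq_zero fun x hx => by simp [hgz x hx]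
  rw [r1, r2]
  have hpt : ∀ x, -(x i * (2 * φ x * fderiv ℝ φ x e)) ≤
      (1 / 2) * φ x ^ 2 + 2 * R ^ 2 * ‖gradient φ x‖ ^ 2 := by
    intro x
    by_cases hx : x ∈ D.carrier
    · have h1 : |x i| ≤ R := (Real.norm_eq_abs (x i) ▸ PiLp.norm_apply_le x i).trans (hR x hx)
      have h2 : |fderiv ℝ φ x e| ≤ ‖gradient φ x‖ := by
        have h3 : inner ℝ (gradient φ x) e = fderiv ℝ φ x e := by
          simp [gradient]
        rw [← h3]
        refine (abs_real_inner_le_norm _ _).trans ?_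
        simp [hen]
      have h4 : (x i * fderiv ℝ φ x e) ^ 2 ≤ R ^ 2 * ‖gradient φ x‖ ^ 2 := by
        rw [mul_pow]
        exact mul_le_mul (sq_le_sq' (by linarith [(abs_le.1 h1).1]) (abs_le.1 h1).2)
          (sq_le_sq' (by linarith [(abs_le.1 h2).1]) (abs_le.1 h2).2) (sq_nonneg _) (sq_nonneg _)
      nlinarith [sq_nonneg (φ x + 2 * (x i * fderiv ℝ φ x e))]
    · rw [hz x hx]
      have : 0 ≤ 2 * R ^ 2 * ‖gradient φ x‖ ^ 2 := by positivity
      simpa using this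
  have hle : ∫ x, φ x ^ 2 ≤ ∫ x, ((1 / 2) * φ x ^ 2 + 2 * R ^ 2 * ‖gradient φ x‖ ^ 2) := by
    rw [key, ← integral_neg]
    refine integral_mono ?_ ((isq.const_mul _).add (igr.const_mul _)) hpt
    exact ((hi.mul ((continuous_const.mul hcont).mul hfe)).integrable_of_hasCompactSupport
        ((hφ.compact.mul_left (f := fun _ => (2 : ℝ))).mul_right.mul_left)).neg
  rw [integral_add (isq.const_mul _) (igr.const_mul _), integral_const_mul,
    integral_const_mul] at hle
  linarith

theorem norm_fst_le {R : ℝ} (hR : ∀ x ∈ D.carrier, ‖x‖ ≤ R) (hR0 : 0 ≤ R)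
    {p : D.PairSpace} (hp : p ∈ D.testPairs.topologicalClosure) : ‖p.1‖ ≤ 2 * R * ‖p.2‖ := by
  have hcl : IsClosed {p : D.PairSpace | ‖p.1‖ ≤ 2 * R * ‖p.2‖} :=
    isClosed_le (by fun_prop) (by fun_prop)
  refine (closure_minimal ?_ hcl) hp
  rintro q ⟨φ, hφ, h1, h2⟩
  have e1 : ‖q.1‖ ^ 2 = ∫ x, φ x ^ 2 ∂D.vol := by
    rw [← real_inner_self_eq_norm_sq, L2.inner_def]
    refine integral_congr_ae ?_
    filter_upwards [h1] with x hx
    rw [hx, real_inner_self_eq_norm_sq, Real.norm_eq_abs, sq_abs]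
  have e2 : ‖q.2‖ ^ 2 = ∫ x, ‖gradient φ x‖ ^ 2 ∂D.vol := by
    rw [← real_inner_self_eq_norm_sq, L2.inner_def]
    refine integral_congr_ae ?_
    filter_upwards [h2] with x hx
    rw [hx, real_inner_self_eq_norm_sq]
  have := D.test_poincare hR hφ
  rw [← e1, ← e2] at this
  refine (sq_le_sq₀ (norm_nonneg _) (by positivity)).1 ?_
  rw [mul_pow, mul_pow]
  linarith

/-- The Sobolev space `H¹₀(D)`: the closure of `C_c^∞(D)` in `H¹(D)`, where a function is recorded
together with its weak gradient. -/
def H10 : Type := D.testPairs.topologicalClosure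

namespace H10

instance : AddCommGroup D.H10 := inferInstanceAs (AddCommGroup D.testPairs.topologicalClosure)

instance : Module ℝ D.H10 := inferInstanceAs (Module ℝ D.testPairs.topologicalClosure)

variable {D}

/-- The underlying function of an element of `H¹₀(D)`. -/
def toFun : D.H10 →ₗ[ℝ] Lp ℝ 2 D.vol :=
  (LinearMap.fst ℝ _ _) ∘ₗ D.testPairs.topologicalClosure.subtype

/-- The weak gradient of an element of `H¹₀(D)`. -/
def grad : D.H10 →ₗ[ℝ] Lp (EuclideanSpace ℝ (Fin d)) 2 D.vol :=
  (LinearMap.snd ℝ _ _) ∘ₗ D.testPairs.topologicalClosure.subtype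

theorem grad_injective : Function.Injective (grad : D.H10 →ₗ[ℝ] _) := by
  rw [injective_iff_map_eq_zero]
  intro v hv
  obtain ⟨R, hR⟩ := D.isBounded.exists_norm_le
  have h := D.norm_fst_le (R := max R 0) (fun x hx => (hR x hx).trans (le_max_left _ _))
    (le_max_right _ _) v.2
  have h2 : v.1.2 = 0 := hv
  rw [h2, norm_zero, mul_zero] at h
  exact Subtype.ext (Prod.ext (norm_le_zero_iff.1 h) h2)

/-- The norm `‖v‖ = ‖∇v‖_{L²(D)}` on `H¹₀(D)`. -/
instance : NormedAddCommGroup D.H10 := NormedAddCommGroup.induced _ _ grad grad_injective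

/-- The inner product `⟨v, w⟩ = ⟨∇v, ∇w⟩_{L²(D)}` on `H¹₀(D)`. -/
instance : InnerProductSpace ℝ D.H10 where
  norm_smul_le c v := by
    change ‖grad (c • v)‖ ≤ ‖c‖ * ‖grad v‖
    rw [map_smul, norm_smul]
  inner v w := inner ℝ (grad v) (grad w)
  norm_sq_eq_re_inner v := (real_inner_self_eq_norm_sq (grad v)).symm
  conj_inner_symm v w := real_inner_comm (grad v) (grad w)
  add_left u v w := by
    change inner ℝ (grad (u + v)) (grad w) = _
    rw [map_add, inner_add_left]
  smul_left u v c := by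
    change inner ℝ (grad (c • u)) (grad v) = _
    rw [map_smul, real_inner_smul_left]
    rfl

end H10

/-- The dual space `H⁻¹(D)` of `H¹₀(D)`, with the dual (operator) norm; `f v` is the duality
pairing. -/
abbrev Hneg1 : Type := StrongDual ℝ D.H10

/-- `w ∈ H¹₀(D)` is a weak solution of `-∇ · (κ ∇w) = f`: for all `v ∈ H¹₀(D)` the integral
`∫_D κ ∇w · ∇v` exists and equals `⟨f, v⟩`. -/
def IsWeakSolution (κ : EuclideanSpace ℝ (Fin d) → ℝ) (f : D.Hneg1) (w : D.H10) : Prop :=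
  ∀ v : D.H10,
    Integrable (fun x => κ x * inner ℝ (H10.grad w x) (H10.grad v x)) D.vol ∧
      ∫ x, κ x * inner ℝ (H10.grad w x) (H10.grad v x) ∂D.vol = f v

end BoundedOpen

/-! ### Parameters, multi-indices and mixed partial derivatives -/

/-- The parameter set `U_{α,τ} = {y ∈ ℝ^ℕ : ∑ⱼ αⱼ |yⱼ|^τ < ∞}`. -/
def paramSet (α : ℕ → ℝ) (τ : ℝ) : Set (ℕ → ℝ) :=
  {y | Summable fun j => α j * |y j| ^ τ}

/-- `bᵛ = ∏ⱼ bⱼ^{νⱼ}` for a finitely supported multi-index `ν`. -/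
def multiPow (b : ℕ → ℝ) (ν : ℕ →₀ ℕ) : ℝ := ν.prod fun j k => b j ^ k

section Derivatives

variable {E : Type*} [NormedAddCommGroup E] [NormedSpace ℝ E]

/-- The partial derivative `∂g/∂yⱼ`. -/
def partialDeriv (j : ℕ) (g : (ℕ → ℝ) → E) : (ℕ → ℝ) → E :=
  fun y => deriv (fun t : ℝ => g (Function.update y j t)) (y j)

/-- The mixed partial derivative `∂ᵛg = ∏ⱼ ∂^{νⱼ}/∂yⱼ^{νⱼ} g`, the derivatives being taken in the
order of decreasing `j`. -/
def mixedPartial (ν : ℕ →₀ ℕ) (g : (ℕ → ℝ) → E) : (ℕ → ℝ) → E :=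
  (ν.support.sort (· ≤ ·)).foldr (fun j h => (partialDeriv j)^[ν j] h) g

/-- `g` has mixed partial derivatives of all orders at all points of `U`, and they do not depend on
the order of differentiation: each `∂ᵛg` is differentiable in each `yⱼ`, with derivative
`∂^{ν+eⱼ}g`. -/
def HasAllMixedPartials (U : Set (ℕ → ℝ)) (g : (ℕ → ℝ) → E) : Prop :=
  ∀ ν : ℕ →₀ ℕ, ∀ y ∈ U, ∀ j : ℕ,
    HasDerivAt (fun t : ℝ => mixedPartial ν g (Function.update y j t))
      (mixedPartial (ν + Finsupp.single j 1) g y) (y j)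

end Derivatives

/-! ### The assumptions on the coefficient -/

/-- `a_min(y) = c exp(-∑ⱼ αⱼ |yⱼ|^τ)`. -/
def aMin (c : ℝ) (α : ℕ → ℝ) (τ : ℝ) (y : ℕ → ℝ) : ℝ :=
  c * Real.exp (-∑' j, α j * |y j| ^ τ)

/-- The coefficient `a : D × U → ℝ` has partial derivatives of all orders with respect to `y ∈ U`,
and `‖∂ᵛa(·,y) / a(·,y)‖_{L^∞(D)} ≤ C (|ν|!)^σ bᵛ` for all `y ∈ U` and all multi-indices `ν`. -/
structure IsGevreyCoefficient {d : ℕ} (D : BoundedOpen d) (U : Set (ℕ → ℝ))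
    (a : EuclideanSpace ℝ (Fin d) → (ℕ → ℝ) → ℝ) (σ C : ℝ) (b : ℕ → ℝ) : Prop where
  one_le_sigma : 1 ≤ σ
  C_pos : 0 < C
  b_nonneg : ∀ j, 0 ≤ b j
  measurable : ∀ y ∈ U, AEStronglyMeasurable (fun x => a x y) D.vol
  smooth : ∀ x ∈ D.carrier, HasAllMixedPartials U (a x)
  bound : ∀ y ∈ U, ∀ ν : ℕ →₀ ℕ,
    eLpNorm (fun x => mixedPartial ν (a x) y / a x y) ⊤ D.vol ≤
      ENNReal.ofReal (C * (ν.degree.factorial : ℝ) ^ σ * multiPow b ν)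

/-- `a(x,y) ≥ a_min(y)` for all `x ∈ D` and `y ∈ U_{α,τ}`, where `c > 0`, `0 < τ ≤ β`, and
`α ∈ ℓ¹(ℕ)` is nonnegative, with `‖α‖_∞ < 1/β` if `τ = β`. -/
structure IsLowerBounded {d : ℕ} (D : BoundedOpen d)
    (a : EuclideanSpace ℝ (Fin d) → (ℕ → ℝ) → ℝ) (c : ℝ) (α : ℕ → ℝ) (τ β : ℝ) : Prop where
  c_pos : 0 < c
  tau_pos : 0 < τ
  tau_le : τ ≤ β
  alpha_nonneg : ∀ j, 0 ≤ α j
  alpha_summable : Summable α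
  alpha_lt : τ = β → (⨆ j, |α j|) < β⁻¹
  lower : ∀ x ∈ D.carrier, ∀ y ∈ paramSet α τ, aMin c α τ y ≤ a x y

end

/-!
Fix `y₀` and let `H` be the Hilbert space of all `√a(·,y₀) ∇v ∈ L²(D)`, that is, of the `v ∈ H¹₀(D)`
with finite energy at `y₀`. Any other coefficient `a(·,y)` comparable to `a(·,y₀)` acts on `H` by a
bounded invertible operator `T(y)`, the compression of multiplication by `a(·,y) / a(·,y₀)`. The
equation reads `T(y) g = F`, hence `u(y) = J T(y)⁻¹ F` with `‖J‖ ‖F‖ ≤ ‖f‖ / a_min(y₀)`. Working in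
`H` rather than in `H¹₀(D)` makes `T(y₀) = 1` and `‖∂ᵛT(y₀)‖ ≤ C (|ν|!)^σ bᵛ`, with no loss from the
ratio of the upper to the lower bound of `a(·,y₀)`, which need not even be finite.

Divided by `ν!`, the derivatives of `T⁻¹` at a point are the coefficients of the inverse of the
formal Taylor series of `T`. Let `θₙ (|ν|!)^σ bᵛ`, `n = |ν|`, bound `‖∂ᵛT⁻¹(y₀)‖`. As `σ ≥ 1`, the
multinomial Vandermonde identity reduces the recursion for the coefficients of an inverse series to
`θₙ = C ∑_{k<n} θₖ`, `θ₀ = 1`, whose solution is `θₙ = C (C + 1)ⁿ⁻¹`.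
-/

noncomputable section

open Finsupp (single)

/-! ### Formal partial derivatives and inverses of power series -/

section FormalPowerSeries

open Finset MvPowerSeries

variable {ι : Type*}

theorem sum_antidiagonal_add_single_fst [DecidableEq ι] {M : Type*} [AddCommMonoid M]
    (F : (ι →₀ ℕ) → (ι →₀ ℕ) → M) (ν : ι →₀ ℕ) (j : ι) :
    ∑ p ∈ HasAntidiagonal.antidiagonal (ν + single j 1),
        (p : (ι →₀ ℕ) × (ι →₀ ℕ)).1 j • F p.1 p.2 =
      ∑ p ∈ HasAntidiagonal.antidiagonal ν, (p.1 j + 1) • F (p.1 + single j 1) p.2 := by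
  rw [← sum_filter_of_ne (p := fun p => single j 1 ≤ p.1) fun p _ hp =>
    Finsupp.single_le_iff.2 (Nat.one_le_iff_ne_zero.2 fun h => hp (by rw [h, zero_smul]))]
  symm
  refine sum_bij' (fun p _ => (p.1 + single j 1, p.2)) (fun p _ => (p.1 - single j 1, p.2))
    ?_ ?_ ?_ ?_ ?_
  · rintro ⟨μ, κ⟩ h
    rw [HasAntidiagonal.mem_antidiagonal] at h
    simp [← h, add_right_comm]
  · rintro ⟨μ, κ⟩ h
    rw [mem_filter, HasAntidiagonal.mem_antidiagonal] at h
    rw [HasAntidiagonal.mem_antidiagonal, ← add_left_inj (single j 1), ← h.1, add_right_comm,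
      tsub_add_cancel_of_le h.2]
  · simp
  · rintro ⟨μ, κ⟩ h
    rw [mem_filter] at h
    simp [tsub_add_cancel_of_le h.2]
  · simp

theorem sum_antidiagonal_add_single_snd [DecidableEq ι] {M : Type*} [AddCommMonoid M]
    (F : (ι →₀ ℕ) → (ι →₀ ℕ) → M) (ν : ι →₀ ℕ) (j : ι) :
    ∑ p ∈ HasAntidiagonal.antidiagonal (ν + single j 1),
        (p : (ι →₀ ℕ) × (ι →₀ ℕ)).2 j • F p.1 p.2 =
      ∑ p ∈ HasAntidiagonal.antidiagonal ν, (p.2 j + 1) • F p.1 (p.2 + single j 1) := by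
  rw [Finsupp.sum_antidiagonal_swap _ fun μ κ => κ j • F μ κ,
    Finsupp.sum_antidiagonal_swap ν fun μ κ => (κ j + 1) • F μ (κ + single j 1)]
  exact sum_antidiagonal_add_single_fst (fun μ κ => F κ μ) ν j

/-- The product rule; Mathlib has it for commutative coefficients only. -/
theorem pderivFun_mul {A : Type*} [Semiring A] (j : ι) (φ ψ : MvPowerSeries ι A) :
    pderivFun j (φ * ψ) = pderivFun j φ * ψ + φ * pderivFun j ψ := by
  classical
  ext ν
  have hsplit : ∀ p ∈ HasAntidiagonal.antidiagonal (ν + single j 1),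
      (ν j + 1) • (coeff p.1 φ * coeff p.2 ψ) =
        p.1 j • (coeff p.1 φ * coeff p.2 ψ) + p.2 j • (coeff p.1 φ * coeff p.2 ψ) := by
    intro p hp
    rw [← add_smul, ← Finsupp.add_apply, HasAntidiagonal.mem_antidiagonal.1 hp]
    simp
  have hcast (n : ℕ) (x : A) : x * ((n : A) + 1) = (n + 1) • x := by
    rw [nsmul_eq_mul, (Nat.cast_commute _ _).eq]; push_cast; rfl
  simp only [map_add, coeff_pderivFun, coeff_mul, hcast, smul_sum, sum_congr rfl hsplit,
    sum_add_distrib, sum_antidiagonal_add_single_fst fun μ κ => coeff μ φ * coeff κ ψ,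
    sum_antidiagonal_add_single_snd fun μ κ => coeff μ φ * coeff κ ψ, smul_mul_assoc, mul_smul_comm]

variable {A : Type*} [Ring A]

theorem pderivFun_ringInverse {φ : MvPowerSeries ι A} (hφ : IsUnit φ) (j : ι) :
    pderivFun j (Ring.inverse φ) = -(Ring.inverse φ * pderivFun j φ * Ring.inverse φ) := by
  have hprod : φ * pderivFun j (Ring.inverse φ) = -(pderivFun j φ * Ring.inverse φ) := by
    rw [eq_neg_iff_add_eq_zero, add_comm, ← pderivFun_mul, Ring.mul_inverse_cancel _ hφ,
      pderivFun_one]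
  rw [← Ring.inverse_mul_cancel_left _ (pderivFun j (Ring.inverse φ)) hφ, hprod, mul_neg,
    mul_assoc]

theorem constantCoeff_ringInverse (φ : MvPowerSeries ι A) :
    constantCoeff (Ring.inverse φ) = Ring.inverse (constantCoeff φ) := by
  by_cases hφ : IsUnit φ
  · rw [Ring.inverse_of_isUnit hφ]
    exact (Ring.inverse_unit (Units.map (constantCoeff (R := A)).toMonoidHom hφ.unit)).symm
  · rw [Ring.inverse_non_unit _ hφ, map_zero,
      Ring.inverse_non_unit _ (mt isUnit_iff_constantCoeff.2 hφ)]

theorem degree_fst_ne_zero_of_mem_erase_antidiagonal [DecidableEq ι] {ν : ι →₀ ℕ}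
    {p : (ι →₀ ℕ) × (ι →₀ ℕ)} (hp : p ∈ (HasAntidiagonal.antidiagonal ν).erase (0, ν)) :
    p.1.degree ≠ 0 := by
  obtain ⟨μ, κ⟩ := p
  rw [mem_erase, HasAntidiagonal.mem_antidiagonal] at hp
  rw [Ne, Finsupp.degree_eq_zero_iff]
  rintro rfl
  simp at hp

theorem degree_snd_lt_of_mem_erase_antidiagonal [DecidableEq ι] {ν : ι →₀ ℕ}
    {p : (ι →₀ ℕ) × (ι →₀ ℕ)} (hp : p ∈ (HasAntidiagonal.antidiagonal ν).erase (0, ν)) :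
    p.2.degree < ν.degree := by
  rw [← HasAntidiagonal.mem_antidiagonal.1 (mem_of_mem_erase hp), map_add]
  have := degree_fst_ne_zero_of_mem_erase_antidiagonal hp
  omega

theorem coeff_ringInverse [DecidableEq ι] (φ : MvPowerSeries ι A) (ν : ι →₀ ℕ) :
    coeff ν (Ring.inverse φ) = Ring.inverse (constantCoeff φ) * (coeff ν (1 : MvPowerSeries ι A) -
      ∑ p ∈ (HasAntidiagonal.antidiagonal ν).erase (0, ν),
        coeff p.1 φ * coeff p.2 (Ring.inverse φ)) := by
  by_cases hφ : IsUnit φ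
  · have hmem : ((0 : ι →₀ ℕ), ν) ∈ HasAntidiagonal.antidiagonal ν := by simp
    rw [← Ring.mul_inverse_cancel _ hφ, coeff_mul, ← add_sum_erase _ _ hmem, add_sub_cancel_right,
      coeff_zero_eq_constantCoeff_apply,
      Ring.inverse_mul_cancel_left _ _ (isUnit_iff_constantCoeff.1 hφ)]
  · rw [Ring.inverse_non_unit _ hφ, Ring.inverse_non_unit _ (mt isUnit_iff_constantCoeff.2 hφ),
      map_zero, zero_mul]

end FormalPowerSeries

section DifferentiableCoefficients

open Finset MvPowerSeries

variable {ι 𝕜 A : Type*} [NontriviallyNormedField 𝕜] [NormedRing A] [NormedAlgebra 𝕜 A]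

/-- The coefficientwise derivative of a power series depending on a parameter. -/
def HasCoeffDerivAt (φ : 𝕜 → MvPowerSeries ι A) (φ' : MvPowerSeries ι A) (t : 𝕜) : Prop :=
  ∀ ν, HasDerivAt (fun s => coeff ν (φ s)) (coeff ν φ') t

theorem HasCoeffDerivAt.mul {φ ψ : 𝕜 → MvPowerSeries ι A} {φ' ψ' : MvPowerSeries ι A} {t : 𝕜}
    (hφ : HasCoeffDerivAt φ φ' t) (hψ : HasCoeffDerivAt ψ ψ' t) :
    HasCoeffDerivAt (fun s => φ s * ψ s) (φ' * ψ t + φ t * ψ') t := by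
  classical
  intro ν
  simp only [map_add, coeff_mul, ← sum_add_distrib]
  exact HasDerivAt.fun_sum fun p _ => (hφ p.1).mul (hψ p.2)

theorem HasCoeffDerivAt.unique {φ : 𝕜 → MvPowerSeries ι A} {φ₁ φ₂ : MvPowerSeries ι A} {t : 𝕜}
    (h₁ : HasCoeffDerivAt φ φ₁ t) (h₂ : HasCoeffDerivAt φ φ₂ t) : φ₁ = φ₂ := by
  ext ν
  exact (h₁ ν).unique (h₂ ν)

variable [CompleteSpace A]

theorem differentiableAt_coeff_ringInverse {φ : 𝕜 → MvPowerSeries ι A} {t : 𝕜}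
    (hφ : ∀ ν, DifferentiableAt 𝕜 (fun s => coeff ν (φ s)) t) (hu : IsUnit (φ t)) (ν : ι →₀ ℕ) :
    DifferentiableAt 𝕜 (fun s => coeff ν (Ring.inverse (φ s))) t := by
  classical
  induction hn : ν.degree using Nat.strong_induction_on generalizing ν with
  | _ n ih =>
    have hconst : DifferentiableAt 𝕜 (fun s => Ring.inverse (constantCoeff (φ s))) t :=
      (differentiableAt_inverse (isUnit_constantCoeff _ hu)).comp t
        (f := fun s => constantCoeff (φ s)) (hφ 0)
    have hlower : DifferentiableAt 𝕜 (fun s => ∑ p ∈ (HasAntidiagonal.antidiagonal ν).erase (0, ν),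
        coeff p.1 (φ s) * coeff p.2 (Ring.inverse (φ s))) t :=
      DifferentiableAt.fun_sum fun p hp => (hφ p.1).mul
        (ih _ (hn ▸ degree_snd_lt_of_mem_erase_antidiagonal hp) p.2 rfl)
    simp only [coeff_ringInverse _ ν]
    exact hconst.mul ((differentiableAt_const _).sub hlower)

theorem HasCoeffDerivAt.ringInverse {φ : 𝕜 → MvPowerSeries ι A} {φ' : MvPowerSeries ι A} {t : 𝕜}
    (hφ : HasCoeffDerivAt φ φ' t) (hu : IsUnit (φ t)) :
    HasCoeffDerivAt (fun s => Ring.inverse (φ s))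
      (-(Ring.inverse (φ t) * φ' * Ring.inverse (φ t))) t := by
  obtain ⟨ψ', hψ⟩ : ∃ ψ', HasCoeffDerivAt (fun s => Ring.inverse (φ s)) ψ' t :=
    ⟨_, fun ν => (differentiableAt_coeff_ringInverse (fun ν => (hφ ν).differentiableAt) hu
      ν).hasDerivAt⟩
  -- Differentiate `φ⁻¹ φ φ⁻¹ = φ⁻¹`, which holds whether or not `φ` is a unit.
  have hinv (χ : MvPowerSeries ι A) : Ring.inverse χ * (χ * Ring.inverse χ) = Ring.inverse χ := by
    by_cases hχ : IsUnit χ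
    · rw [Ring.mul_inverse_cancel _ hχ, mul_one]
    · rw [Ring.inverse_non_unit _ hχ, zero_mul]
  have hprod := hψ.mul (hφ.mul hψ)
  simp only [hinv, Ring.mul_inverse_cancel _ hu, mul_one, mul_add,
    Ring.inverse_mul_cancel_left _ _ hu] at hprod
  have hψ' : Ring.inverse (φ t) * (φ' * Ring.inverse (φ t)) + ψ' = 0 :=
    left_eq_add.1 (hψ.unique hprod)
  rwa [mul_assoc, neg_eq_of_add_eq_zero_right hψ']

theorem HasCoeffDerivAt.pderivFun_ringInverse {φ : 𝕜 → MvPowerSeries ι A} {t : 𝕜} {j : ι}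
    (hφ : HasCoeffDerivAt φ (pderivFun j (φ t)) t) (hu : IsUnit (φ t)) :
    HasCoeffDerivAt (fun s => Ring.inverse (φ s)) (pderivFun j (Ring.inverse (φ t))) t := by
  rw [_root_.pderivFun_ringInverse hu]
  exact hφ.ringInverse hu

end DifferentiableCoefficients

/-! ### Series of Gevrey type -/

section MultiIndex

variable {ι : Type*}

/-- `ν! = ∏ⱼ νⱼ!`. -/
def multiFactorial (ν : ι →₀ ℕ) : ℝ := ν.prod fun _ k => (k.factorial : ℝ)

theorem multiFactorial_zero : multiFactorial (0 : ι →₀ ℕ) = 1 := Finsupp.prod_zero_index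

theorem multiFactorial_pos (ν : ι →₀ ℕ) : 0 < multiFactorial ν :=
  Finset.prod_pos fun _ _ => by positivity

theorem multiFactorial_add_single (ν : ι →₀ ℕ) (j : ι) :
    multiFactorial (ν + single j 1) = (ν j + 1) * multiFactorial ν := by
  classical
  have hzero (_ : ι) : (((0 : ℕ).factorial : ℕ) : ℝ) = 1 := by simp
  have herase : (ν + single j 1).erase j = ν.erase j := by simp
  rw [multiFactorial, multiFactorial, ← Finsupp.mul_prod_erase' _ j _ hzero,
    ← Finsupp.mul_prod_erase' ν j _ hzero, herase, ← mul_assoc]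
  simp [Nat.factorial_succ]

theorem multiIndex_induction {P : (ι →₀ ℕ) → Prop} (zero : P 0)
    (add_single : ∀ ν j, P ν → P (ν + single j 1)) (ν : ι →₀ ℕ) : P ν := by
  induction hn : ν.degree generalizing ν with
  | zero => rwa [(Finsupp.degree_eq_zero_iff ν).1 hn]
  | succ n ih =>
    obtain ⟨j, hj⟩ : ∃ j, ν j ≠ 0 := by
      by_contra! h
      simp [show ν = 0 from Finsupp.ext h] at hn
    have hν : ν - single j 1 + single j 1 = ν :=
      tsub_add_cancel_of_le (Finsupp.single_le_iff.2 (Nat.one_le_iff_ne_zero.2 hj))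
    have hdegree : (ν - single j 1).degree = n := by
      rw [← hν, map_add, Finsupp.degree_single] at hn
      exact Nat.succ.inj hn
    exact hν ▸ add_single _ j (ih _ hdegree)

theorem multiPow_zero (b : ℕ → ℝ) : multiPow b 0 = 1 := Finsupp.prod_zero_index

theorem multiPow_add (b : ℕ → ℝ) (μ κ : ℕ →₀ ℕ) :
    multiPow b (μ + κ) = multiPow b μ * multiPow b κ :=
  Finsupp.prod_add_index' (fun _ => pow_zero _) fun _ _ _ => pow_add _ _ _

theorem multiPow_nonneg {b : ℕ → ℝ} (hb : ∀ j, 0 ≤ b j) (ν : ℕ →₀ ℕ) : 0 ≤ multiPow b ν :=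
  Finset.prod_nonneg fun _ _ => pow_nonneg (hb _) _

end MultiIndex

section DegreeSeries

open Finset MvPowerSeries

variable {ι : Type*}

/-- The exponential generating series `∑_ν g(|ν|) X^ν / ν!` of a sequence `g`. -/
def degreeSeries (g : ℕ → ℝ) : MvPowerSeries ι ℝ := fun ν => g ν.degree / multiFactorial ν

theorem coeff_degreeSeries (g : ℕ → ℝ) (ν : ι →₀ ℕ) :
    coeff ν (degreeSeries g) = g ν.degree / multiFactorial ν := rfl

theorem pderivFun_degreeSeries (g : ℕ → ℝ) (j : ι) :
    pderivFun j (degreeSeries g) = degreeSeries fun n => g (n + 1) := by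
  ext ν
  have hν : (ν j : ℝ) + 1 ≠ 0 := by positivity
  rw [coeff_pderivFun, coeff_degreeSeries, coeff_degreeSeries, multiFactorial_add_single, map_add,
    Finsupp.degree_single]
  field_simp

/-- Comparing coefficients, this is the multinomial Vandermonde identity. -/
theorem degreeSeries_mul (g h : ℕ → ℝ) :
    (degreeSeries g * degreeSeries h : MvPowerSeries ι ℝ) = degreeSeries fun n =>
      ∑ p ∈ HasAntidiagonal.antidiagonal n, n.choose p.1 * (g p.1 * h p.2) := by
  ext ν
  induction ν using multiIndex_induction generalizing g h with
  | zero =>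
    classical simp [coeff_mul, coeff_degreeSeries, multiFactorial_zero]
  | add_single ν j ih =>
    have hν : (ν j : ℝ) + 1 ≠ 0 := by positivity
    have hsymm (n : ℕ) (f : ℕ → ℕ → ℝ) :
        ∑ p ∈ HasAntidiagonal.antidiagonal n, (n.choose p.2 : ℝ) * f p.1 p.2 =
          ∑ p ∈ HasAntidiagonal.antidiagonal n, (n.choose p.1 : ℝ) * f p.1 p.2 :=
      sum_congr rfl fun p hp => by
        rw [Nat.choose_symm_of_eq_add (HasAntidiagonal.mem_antidiagonal.1 hp).symm]
    apply mul_right_cancel₀ hν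
    rw [← coeff_pderivFun, ← coeff_pderivFun, pderivFun_mul]
    simp only [pderivFun_degreeSeries, map_add, ih, coeff_degreeSeries]
    rw [sum_antidiagonal_choose_succ_mul fun m n => g m * h n, hsymm _ fun m n => g (m + 1) * h n]
    ring

end DegreeSeries

section Gevrey

open Finset MvPowerSeries

/-- `θ₀ = 1` and `θₙ = C (C + 1)ⁿ⁻¹` for `n ≥ 1`: the growth rate of the inverse of a Gevrey series
with constant `C`. -/
def gevreyFactor (C : ℝ) (n : ℕ) : ℝ := if n = 0 then 1 else C * (C + 1) ^ (n - 1)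

theorem gevreyFactor_nonneg {C : ℝ} (hC : 0 ≤ C) (n : ℕ) : 0 ≤ gevreyFactor C n := by
  unfold gevreyFactor
  split_ifs <;> positivity

theorem sum_range_gevreyFactor (C : ℝ) (n : ℕ) :
    ∑ k ∈ range (n + 1), gevreyFactor C k = (C + 1) ^ n := by
  induction n with
  | zero => simp [gevreyFactor]
  | succ n ih =>
    rw [sum_range_succ, ih, gevreyFactor, if_neg n.succ_ne_zero, Nat.add_sub_cancel]
    ring

theorem sum_antidiagonal_gevreyFactor_snd (C : ℝ) {n : ℕ} (hn : n ≠ 0) :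
    ∑ p ∈ HasAntidiagonal.antidiagonal n, C * (if p.1 = 0 then 0 else gevreyFactor C p.2) =
      gevreyFactor C n := by
  obtain ⟨n, rfl⟩ := Nat.exists_eq_succ_of_ne_zero hn
  rw [← mul_sum, Nat.sum_antidiagonal_succ, ← Nat.sum_antidiagonal_swap]
  simp only [Prod.fst_swap, Prod.snd_swap, Nat.add_eq_zero_iff, one_ne_zero, and_false, if_true,
    if_false, zero_add]
  rw [Nat.sum_antidiagonal_eq_sum_range_succ fun m _ => gevreyFactor C m, sum_range_gevreyFactor,
    gevreyFactor, if_neg n.succ_ne_zero, Nat.succ_sub_one]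

theorem choose_mul_rpow_factorial_le {σ : ℝ} (hσ : 1 ≤ σ) (m k : ℕ) :
    ((m + k).choose m : ℝ) * ((m.factorial : ℝ) ^ σ * (k.factorial : ℝ) ^ σ) ≤
      ((m + k).factorial : ℝ) ^ σ := by
  have hchoose : (1 : ℝ) ≤ (m + k).choose m := by
    exact_mod_cast Nat.choose_pos (Nat.le_add_right m k)
  calc ((m + k).choose m : ℝ) * ((m.factorial : ℝ) ^ σ * (k.factorial : ℝ) ^ σ)
      ≤ ((m + k).choose m : ℝ) ^ σ * ((m.factorial : ℝ) ^ σ * (k.factorial : ℝ) ^ σ) := by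
        gcongr
        simpa only [Real.rpow_one] using Real.rpow_le_rpow_of_exponent_le hchoose hσ
    _ = ((m + k).factorial : ℝ) ^ σ := by
        rw [← Real.mul_rpow (by positivity) (by positivity),
          ← Real.mul_rpow (by positivity) (by positivity), ← mul_assoc,
          ← Nat.add_choose_mul_factorial_mul_factorial m k, Nat.choose_symm_add]
        push_cast
        rfl

theorem sum_choose_gevreyFactor_le {σ C : ℝ} (hσ : 1 ≤ σ) (hC : 0 ≤ C) {n : ℕ} (hn : n ≠ 0) :
    ∑ p ∈ HasAntidiagonal.antidiagonal n, (n.choose p.1 : ℝ) *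
      ((if p.1 = 0 then 0 else C * (p.1.factorial : ℝ) ^ σ) *
        (gevreyFactor C p.2 * (p.2.factorial : ℝ) ^ σ)) ≤
      gevreyFactor C n * (n.factorial : ℝ) ^ σ := by
  rw [← sum_antidiagonal_gevreyFactor_snd C hn, sum_mul]
  refine sum_le_sum fun p hp => ?_
  obtain rfl := HasAntidiagonal.mem_antidiagonal.1 hp
  split_ifs with h
  · simp
  · have hfactor := mul_le_mul_of_nonneg_left (choose_mul_rpow_factorial_le hσ p.1 p.2)
      (mul_nonneg hC (gevreyFactor_nonneg hC p.2))
    linarith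

theorem coeff_degreeSeries_mul_gevrey_le {ι : Type*} {σ C : ℝ} (hσ : 1 ≤ σ) (hC : 0 ≤ C)
    {ν : ι →₀ ℕ} (hν : ν ≠ 0) :
    coeff ν (degreeSeries (fun m => if m = 0 then 0 else C * (m.factorial : ℝ) ^ σ) *
      degreeSeries fun m => gevreyFactor C m * (m.factorial : ℝ) ^ σ) ≤
    gevreyFactor C ν.degree * (ν.degree.factorial : ℝ) ^ σ / multiFactorial ν := by
  rw [degreeSeries_mul, coeff_degreeSeries]
  exact div_le_div_of_nonneg_right
    (sum_choose_gevreyFactor_le hσ hC (mt (Finsupp.degree_eq_zero_iff ν).1 hν))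
    (multiFactorial_pos ν).le

/-- The Gevrey majorant `C (|ν|!)^σ bᵛ` of order `σ`. -/
def gevreyBound (σ C : ℝ) (b : ℕ → ℝ) (ν : ℕ →₀ ℕ) : ℝ :=
  C * (ν.degree.factorial : ℝ) ^ σ * multiPow b ν

theorem gevreyBound_nonneg {σ C : ℝ} {b : ℕ → ℝ} (hC : 0 ≤ C) (hb : ∀ j, 0 ≤ b j) (ν : ℕ →₀ ℕ) :
    0 ≤ gevreyBound σ C b ν :=
  mul_nonneg (by positivity) (multiPow_nonneg hb ν)

variable {A : Type*} [NormedRing A]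

theorem norm_coeff_ringInverse_le {φ : MvPowerSeries ℕ A} {b : ℕ → ℝ} {σ C : ℝ} (hσ : 1 ≤ σ)
    (hC : 0 ≤ C) (hb : ∀ j, 0 ≤ b j) (hone : ‖(1 : A)‖ ≤ 1) (hφ_one : constantCoeff φ = 1)
    (hφ : ∀ ν, ‖coeff ν φ‖ ≤ gevreyBound σ C b ν / multiFactorial ν) (ν : ℕ →₀ ℕ) :
    ‖coeff ν (Ring.inverse φ)‖ ≤
      gevreyBound σ (gevreyFactor C ν.degree) b ν / multiFactorial ν := by
  induction hn : ν.degree using Nat.strong_induction_on generalizing ν with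
  | _ n ih =>
  subst hn
  obtain rfl | hν := eq_or_ne ν 0
  · simpa [constantCoeff_ringInverse, hφ_one, gevreyBound, gevreyFactor, multiFactorial_zero,
      multiPow_zero]
  let g : ℕ → ℝ := fun m => if m = 0 then 0 else C * (m.factorial : ℝ) ^ σ
  let h : ℕ → ℝ := fun m => gevreyFactor C m * (m.factorial : ℝ) ^ σ
  have hterm : ∀ p ∈ (HasAntidiagonal.antidiagonal ν).erase (0, ν),
      ‖coeff p.1 φ * coeff p.2 (Ring.inverse φ)‖ ≤
        coeff p.1 (degreeSeries g) * coeff p.2 (degreeSeries h) * multiPow b ν := by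
    intro p hp
    have hfst := degree_fst_ne_zero_of_mem_erase_antidiagonal hp
    have hsnd := degree_snd_lt_of_mem_erase_antidiagonal hp
    refine (norm_mul_le_of_le (hφ p.1) (ih _ hsnd p.2 rfl)).trans_eq ?_
    rw [← HasAntidiagonal.mem_antidiagonal.1 (mem_erase.1 hp).2, multiPow_add,
      coeff_degreeSeries, coeff_degreeSeries, gevreyBound, gevreyBound]
    simp only [g, h, if_neg hfst]
    ring
  have hzero : coeff (0 : ℕ →₀ ℕ) (degreeSeries g) = 0 := by simp [coeff_degreeSeries, g]
  calc ‖coeff ν (Ring.inverse φ)‖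
      = ‖∑ p ∈ (HasAntidiagonal.antidiagonal ν).erase (0, ν),
          coeff p.1 φ * coeff p.2 (Ring.inverse φ)‖ := by
        rw [coeff_ringInverse, hφ_one, Ring.inverse_one, one_mul, coeff_one, if_neg hν, zero_sub,
          norm_neg]
    _ ≤ ∑ p ∈ (HasAntidiagonal.antidiagonal ν).erase (0, ν),
          coeff p.1 (degreeSeries g) * coeff p.2 (degreeSeries h) * multiPow b ν :=
        norm_sum_le_of_le _ hterm
    _ = coeff ν (degreeSeries g * degreeSeries h) * multiPow b ν := by
        rw [← sum_mul, coeff_mul, sum_erase _ (by rw [hzero, zero_mul])]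
    _ ≤ gevreyFactor C ν.degree * (ν.degree.factorial : ℝ) ^ σ / multiFactorial ν * multiPow b ν :=
        mul_le_mul_of_nonneg_right (coeff_degreeSeries_mul_gevrey_le hσ hC hν)
          (multiPow_nonneg hb ν)
    _ = gevreyBound σ (gevreyFactor C ν.degree) b ν / multiFactorial ν := by
        rw [gevreyBound]
        ring

end Gevrey

/-! ### Mixed partial derivatives -/

section MixedPartials

variable {E F : Type*} [NormedAddCommGroup E] [NormedSpace ℝ E] [NormedAddCommGroup F]
  [NormedSpace ℝ F] {X : Set (ℕ → ℝ)}

/-- The sets which contain with a point all coordinate lines through it. Partial derivatives along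
such a set are two-sided. -/
def IsUpdateClosed (X : Set (ℕ → ℝ)) : Prop :=
  ∀ y ∈ X, ∀ j t, Function.update y j t ∈ X

/-- `W` is a candidate for the family of all mixed partial derivatives of `g` on `X`: it starts with
`g`, and its members are the partial derivatives of one another. -/
structure IsPartialFamily (X : Set (ℕ → ℝ)) (g : (ℕ → ℝ) → E)
    (W : (ℕ →₀ ℕ) → (ℕ → ℝ) → E) : Prop where
  eqOn_zero : EqOn (W 0) g X
  hasDerivAt : ∀ ν, ∀ y ∈ X, ∀ j, HasDerivAt (fun t => W ν (Function.update y j t))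
    (W (ν + single j 1) y) (y j)

theorem mixedPartial_zero (g : (ℕ → ℝ) → E) : mixedPartial 0 g = g := by
  simp [mixedPartial]

theorem HasAllMixedPartials.hasDerivAt_update {g : (ℕ → ℝ) → E} (hg : HasAllMixedPartials X g)
    (hX : IsUpdateClosed X) {y : ℕ → ℝ} (hy : y ∈ X) (ν : ℕ →₀ ℕ) (j : ℕ) (t : ℝ) :
    HasDerivAt (fun t => mixedPartial ν g (Function.update y j t))
      (mixedPartial (ν + single j 1) g (Function.update y j t)) t := by
  simpa using hg ν _ (hX y hy j t) j

namespace IsPartialFamily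

variable {g : (ℕ → ℝ) → E} {W : (ℕ →₀ ℕ) → (ℕ → ℝ) → E}

theorem iterate_partialDeriv_eqOn (hW : IsPartialFamily X g W) (hX : IsUpdateClosed X)
    {h : (ℕ → ℝ) → E} {μ : ℕ →₀ ℕ} (hμ : EqOn h (W μ) X) (j n : ℕ) :
    EqOn ((partialDeriv j)^[n] h) (W (μ + single j n)) X := by
  induction n with
  | zero => simpa using hμ
  | succ n ih =>
    intro y hy
    have hline : (fun t => (partialDeriv j)^[n] h (Function.update y j t)) =
        fun t => W (μ + single j n) (Function.update y j t) :=
      funext fun t => ih (hX y hy j t)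
    rw [Function.iterate_succ_apply', partialDeriv, hline, (hW.hasDerivAt _ y hy j).deriv,
      add_assoc, ← Finsupp.single_add]

theorem mixedPartial_eqOn (hW : IsPartialFamily X g W) (hX : IsUpdateClosed X) (ν : ℕ →₀ ℕ) :
    EqOn (mixedPartial ν g) (W ν) X := by
  have hfold (l : List ℕ) : EqOn (l.foldr (fun j h => (partialDeriv j)^[ν j] h) g)
      (W (l.map fun j => single j (ν j)).sum) X := by
    induction l with
    | nil => exact hW.eqOn_zero.symm
    | cons j l ih =>
      rw [List.foldr_cons, List.map_cons, List.sum_cons, add_comm]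
      exact hW.iterate_partialDeriv_eqOn hX ih j (ν j)
  have hsum : ((ν.support.sort (· ≤ ·)).map fun j => single j (ν j)).sum = ν := by
    rw [← Multiset.sum_coe, ← Multiset.map_coe, Finset.sort_eq]
    exact ν.sum_single
  have hsorted := hfold (ν.support.sort (· ≤ ·))
  rwa [hsum] at hsorted

theorem hasAllMixedPartials (hW : IsPartialFamily X g W) (hX : IsUpdateClosed X) :
    HasAllMixedPartials X g := by
  intro ν y hy j
  rw [hW.mixedPartial_eqOn hX _ hy,
    funext fun t => hW.mixedPartial_eqOn hX ν (hX y hy j t)]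
  exact hW.hasDerivAt ν y hy j

theorem congr {h : (ℕ → ℝ) → E} (hW : IsPartialFamily X g W) (hgh : EqOn g h X) :
    IsPartialFamily X h W :=
  ⟨hW.eqOn_zero.trans hgh, hW.hasDerivAt⟩

theorem clm_comp (hW : IsPartialFamily X g W) (L : E →L[ℝ] F) :
    IsPartialFamily X (fun y => L (g y)) fun ν y => L (W ν y) where
  eqOn_zero _ hy := congrArg L (hW.eqOn_zero hy)
  hasDerivAt ν y hy j := L.hasFDerivAt.comp_hasDerivAt (y j) (hW.hasDerivAt ν y hy j)

end IsPartialFamily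

end MixedPartials

section InverseFamily

open MvPowerSeries

variable {A : Type*} [NormedRing A] [NormedAlgebra ℝ A] {X : Set (ℕ → ℝ)}

/-- The power series `∑_ν W_ν(y) X^ν / ν!`; for the mixed partial derivatives `W` of a function it
is the Taylor series at `y`. -/
def taylorSeries (W : (ℕ →₀ ℕ) → (ℕ → ℝ) → A) (y : ℕ → ℝ) : MvPowerSeries ℕ A :=
  fun ν => (multiFactorial ν)⁻¹ • W ν y

/-- The family whose Taylor series are the inverses of those of `W`. -/
def inverseFamily (W : (ℕ →₀ ℕ) → (ℕ → ℝ) → A) (ν : ℕ →₀ ℕ) (y : ℕ → ℝ) : A :=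
  multiFactorial ν • coeff ν (Ring.inverse (taylorSeries W y))

theorem coeff_taylorSeries (W : (ℕ →₀ ℕ) → (ℕ → ℝ) → A) (y : ℕ → ℝ) (ν : ℕ →₀ ℕ) :
    coeff ν (taylorSeries W y) = (multiFactorial ν)⁻¹ • W ν y := rfl

theorem constantCoeff_taylorSeries (W : (ℕ →₀ ℕ) → (ℕ → ℝ) → A) (y : ℕ → ℝ) :
    constantCoeff (taylorSeries W y) = W 0 y := by
  rw [← coeff_zero_eq_constantCoeff_apply, coeff_taylorSeries, multiFactorial_zero, inv_one,
    one_smul]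

namespace IsPartialFamily

variable {g : (ℕ → ℝ) → A} {W : (ℕ →₀ ℕ) → (ℕ → ℝ) → A}

theorem hasCoeffDerivAt_taylorSeries (hW : IsPartialFamily X g W) {y : ℕ → ℝ} (hy : y ∈ X)
    (j : ℕ) : HasCoeffDerivAt (fun t => taylorSeries W (Function.update y j t))
      (pderivFun j (taylorSeries W y)) (y j) := by
  intro ν
  refine ((hW.hasDerivAt ν y hy j).const_smul (multiFactorial ν)⁻¹).congr_deriv ?_
  have hν : (ν j : ℝ) + 1 ≠ 0 := by positivity
  have hcast : ((ν j : A) + 1) = algebraMap ℝ A (ν j + 1) := by simp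
  rw [coeff_pderivFun, coeff_taylorSeries, multiFactorial_add_single, hcast,
    ← Algebra.commutes, ← Algebra.smul_def, smul_smul, mul_inv, mul_inv_cancel_left₀ hν]

theorem ringInverse [CompleteSpace A] (hW : IsPartialFamily X g W) (hg : ∀ y ∈ X, IsUnit (g y)) :
    IsPartialFamily X (fun y => Ring.inverse (g y)) (inverseFamily W) where
  eqOn_zero y hy := by
    rw [inverseFamily, multiFactorial_zero, one_smul, coeff_zero_eq_constantCoeff_apply,
      constantCoeff_ringInverse, constantCoeff_taylorSeries, hW.eqOn_zero hy]
  hasDerivAt ν y hy j := by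
    have hunit : IsUnit (taylorSeries W y) := by
      rw [isUnit_iff_constantCoeff, constantCoeff_taylorSeries, hW.eqOn_zero hy]
      exact hg y hy
    have hinverse := HasCoeffDerivAt.pderivFun_ringInverse
      (φ := fun t => taylorSeries W (Function.update y j t)) (t := y j) (j := j)
      (by simpa using hW.hasCoeffDerivAt_taylorSeries hy j) (by simpa using hunit) ν
    simp only [Function.update_eq_self] at hinverse
    refine (hinverse.const_smul (multiFactorial ν)).congr_deriv ?_
    have hcast : ((ν j : A) + 1) = algebraMap ℝ A (ν j + 1) := by simp
    rw [coeff_pderivFun, inverseFamily, multiFactorial_add_single, hcast, ← Algebra.commutes,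
      ← Algebra.smul_def, smul_smul, mul_comm]

end IsPartialFamily

theorem norm_inverseFamily_le {W : (ℕ →₀ ℕ) → (ℕ → ℝ) → A} {y : ℕ → ℝ} {b : ℕ → ℝ} {σ C : ℝ}
    (hσ : 1 ≤ σ) (hC : 0 ≤ C) (hb : ∀ j, 0 ≤ b j) (hone : ‖(1 : A)‖ ≤ 1) (hW_one : W 0 y = 1)
    (hW : ∀ ν, ‖W ν y‖ ≤ gevreyBound σ C b ν) (ν : ℕ →₀ ℕ) :
    ‖inverseFamily W ν y‖ ≤ gevreyBound σ (gevreyFactor C ν.degree) b ν := by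
  have hcoeff (ν : ℕ →₀ ℕ) :
      ‖coeff ν (taylorSeries W y)‖ ≤ gevreyBound σ C b ν / multiFactorial ν := by
    rw [coeff_taylorSeries, norm_smul, norm_inv, Real.norm_of_nonneg (multiFactorial_pos ν).le,
      inv_mul_eq_div]
    exact div_le_div_of_nonneg_right (hW ν) (multiFactorial_pos ν).le
  have hinverse := norm_coeff_ringInverse_le hσ hC hb hone
    ((constantCoeff_taylorSeries W y).trans hW_one) hcoeff ν
  rwa [le_div_iff₀' (multiFactorial_pos ν), ← Real.norm_of_nonneg (multiFactorial_pos ν).le,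
    ← norm_smul] at hinverse

end InverseFamily

/-! ### Calculus on the line -/

section Calculus

theorem le_exp_mul_of_abs_deriv_le {g g' : ℝ → ℝ} {K : ℝ} (hg : ∀ t, HasDerivAt g (g' t) t)
    (hpos : ∀ t, 0 < g t) (hK : ∀ t, |g' t| ≤ K * g t) (s t : ℝ) :
    g t ≤ Real.exp (K * |t - s|) * g s := by
  have hlog (r : ℝ) : HasDerivAt (fun r => Real.log (g r)) (g' r / g r) r :=
    (hg r).log (hpos r).ne'
  have hslope (r : ℝ) : ‖g' r / g r‖ ≤ K := by
    rw [Real.norm_eq_abs, abs_div, abs_of_pos (hpos r), div_le_iff₀ (hpos r)]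
    exact hK r
  have hlog_le : |Real.log (g t) - Real.log (g s)| ≤ K * |t - s| :=
    convex_univ.norm_image_sub_le_of_norm_hasDerivWithin_le
      (fun r _ => (hlog r).hasDerivWithinAt) (fun r _ => hslope r) (mem_univ s) (mem_univ t)
  calc g t = Real.exp (Real.log (g t)) := (Real.exp_log (hpos t)).symm
    _ ≤ Real.exp (K * |t - s| + Real.log (g s)) :=
      Real.exp_le_exp.2 (sub_le_iff_le_add.1 ((le_abs_self _).trans hlog_le))
    _ = Real.exp (K * |t - s|) * g s := by rw [Real.exp_add, Real.exp_log (hpos s)]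

variable {E : Type*} [NormedAddCommGroup E] [NormedSpace ℝ E]

theorem norm_sub_sub_smul_deriv_le {g g' g'' : ℝ → E} {M s t : ℝ}
    (hg : ∀ r, HasDerivAt g (g' r) r) (hg' : ∀ r, HasDerivAt g' (g'' r) r)
    (hM : ∀ r, |r - s| ≤ |t - s| → ‖g'' r‖ ≤ M) :
    ‖g t - g s - (t - s) • g' s‖ ≤ M * (t - s) ^ 2 := by
  have hconvex : Convex ℝ (Metric.closedBall s |t - s|) := convex_closedBall _ _
  have hs : s ∈ Metric.closedBall s |t - s| := by simp
  have ht : t ∈ Metric.closedBall s |t - s| := by simp [Real.dist_eq]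
  have hM_nonneg : 0 ≤ M := (norm_nonneg _).trans (hM s (by simp))
  have hslope (r : ℝ) (hr : r ∈ Metric.closedBall s |t - s|) :
      ‖g' r - g' s‖ ≤ M * |t - s| := by
    rw [Metric.mem_closedBall, Real.dist_eq] at hr
    refine (hconvex.norm_image_sub_le_of_norm_hasDerivWithin_le (C := M)
      (fun r _ => (hg' r).hasDerivWithinAt) (fun r hr => hM r hr) hs hr).trans ?_
    gcongr
    exact hr
  have hremainder (r : ℝ) : HasDerivAt (fun r => g r - r • g' s) (g' r - g' s) r := by
    simpa only [one_smul] using (hg r).fun_sub ((hasDerivAt_id' r).smul_const (g' s))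
  have := hconvex.norm_image_sub_le_of_norm_hasDerivWithin_le
    (fun r _ => (hremainder r).hasDerivWithinAt) hslope hs ht
  rwa [Real.norm_eq_abs, mul_assoc, abs_mul_abs_self, ← sq, sub_sub_sub_comm, ← sub_smul] at this

theorem hasDerivAt_of_norm_le_sq {g : ℝ → E} {g' : E} {s M : ℝ}
    (h : ∀ t, |t - s| ≤ 1 → ‖g t - g s - (t - s) • g'‖ ≤ M * (t - s) ^ 2) :
    HasDerivAt g g' s := by
  have hbigO : (fun t => g t - g s - (t - s) • g') =O[nhds s] fun t => (t - s) ^ 2 := by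
    refine Asymptotics.IsBigO.of_bound M ?_
    filter_upwards [Metric.closedBall_mem_nhds s one_pos] with t ht
    rw [norm_pow, Real.norm_eq_abs, sq_abs]
    exact h t ht
  rw [hasDerivAt_iff_isLittleO]
  exact hbigO.trans_isLittleO (by simpa using Asymptotics.isLittleO_pow_sub_sub s one_lt_two)

end Calculus

section ParametricFunctions

variable {Ω E : Type*} [MeasurableSpace Ω] {μ : Measure Ω} [NormedAddCommGroup E]

theorem norm_Lp_top_le {f : Lp E ⊤ μ} {K : ℝ} (hK : 0 ≤ K) (h : ∀ᵐ x ∂μ, ‖f x‖ ≤ K) : ‖f‖ ≤ K := by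
  rw [Lp.norm_def, eLpNorm_exponent_top]
  exact ENNReal.toReal_le_of_le_ofReal hK (eLpNormEssSup_le_of_ae_bound h)

theorem exists_Lp_top_eq_inv_sqrt {κ : Ω → ℝ} (hmeas : AEStronglyMeasurable κ μ) {k : ℝ}
    (hk : 0 < k) (hκ : ∀ᵐ x ∂μ, k ≤ κ x) :
    ∃ r : Lp ℝ ⊤ μ, (r =ᵐ[μ] fun x => (√(κ x))⁻¹) ∧ ‖r‖ ≤ (√k)⁻¹ := by
  have hbound : ∀ᵐ x ∂μ, ‖(√(κ x))⁻¹‖ ≤ (√k)⁻¹ := by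
    filter_upwards [hκ] with x hx
    rw [Real.norm_of_nonneg (by positivity)]
    exact inv_anti₀ (Real.sqrt_pos.2 hk) (Real.sqrt_le_sqrt hx)
  have hmem : MemLp (fun x => (√(κ x))⁻¹) ⊤ μ :=
    memLp_top_of_bound hmeas.aemeasurable.sqrt.inv.aestronglyMeasurable _ hbound
  refine ⟨hmem.toLp, hmem.coeFn_toLp, norm_Lp_top_le (by positivity) ?_⟩
  filter_upwards [hbound, hmem.coeFn_toLp] with x hx hcoe
  rwa [hcoe]

theorem memLp_top_div {g κ : Ω → ℝ} (hg : AEStronglyMeasurable g μ) (hκ : AEStronglyMeasurable κ μ)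
    (hO : g =O[ae μ] κ) : MemLp (fun x => g x / κ x) ⊤ μ := by
  obtain ⟨K, hK, hbound⟩ := hO.exists_nonneg
  refine memLp_top_of_bound (hg.aemeasurable.div hκ.aemeasurable).aestronglyMeasurable K ?_
  filter_upwards [hbound.bound] with x hx
  rw [norm_div]
  exact div_le_of_le_mul₀ (norm_nonneg _) hK hx

theorem ae_forall_le_of_forall_ae_le {S : Type*} [TopologicalSpace S]
    [TopologicalSpace.SeparableSpace S] {g h : Ω → S → ℝ} (hg : ∀ᵐ x ∂μ, Continuous (g x))
    (hh : ∀ᵐ x ∂μ, Continuous (h x)) (hle : ∀ t, ∀ᵐ x ∂μ, g x t ≤ h x t) :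
    ∀ᵐ x ∂μ, ∀ t, g x t ≤ h x t := by
  obtain ⟨s, hs_countable, hs_dense⟩ := TopologicalSpace.exists_countable_dense S
  filter_upwards [hg, hh, (ae_ball_iff hs_countable).2 fun t _ => hle t] with x hgx hhx hx t
  exact hs_dense.induction hx (isClosed_le hgx hhx) t

variable [NormedSpace ℝ E]

theorem aestronglyMeasurable_of_hasDerivAt {g : Ω → ℝ → E} {g' : Ω → E} {t : ℝ}
    (hg : ∀ s, AEStronglyMeasurable (fun x => g x s) μ)
    (hderiv : ∀ᵐ x ∂μ, HasDerivAt (g x) (g' x) t) : AEStronglyMeasurable g' μ := by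
  refine aestronglyMeasurable_of_tendsto_ae (nhdsWithin (0 : ℝ) {0}ᶜ)
    (f := fun s x => s⁻¹ • (g x (t + s) - g x t))
    (fun s => ((hg (t + s)).sub (hg t)).const_smul s⁻¹) ?_
  filter_upwards [hderiv] with x hx
  exact hasDerivAt_iff_tendsto_slope_zero.1 hx

theorem hasDerivAt_Lp_top {g g' g'' : Ω → ℝ → E} {F : ℝ → Lp E ⊤ μ} {F' : Lp E ⊤ μ} {s M : ℝ}
    (hM : 0 ≤ M) (hF : ∀ t, F t =ᵐ[μ] fun x => g x t) (hF' : F' =ᵐ[μ] fun x => g' x s)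
    (hg : ∀ᵐ x ∂μ, ∀ t, HasDerivAt (g x) (g' x t) t)
    (hg' : ∀ᵐ x ∂μ, ∀ t, HasDerivAt (g' x) (g'' x t) t)
    (hbound : ∀ᵐ x ∂μ, ∀ t, |t - s| ≤ 1 → ‖g'' x t‖ ≤ M) : HasDerivAt F F' s := by
  refine hasDerivAt_of_norm_le_sq (M := M) fun t ht => norm_Lp_top_le (by positivity) ?_
  filter_upwards [Lp.coeFn_sub (F t - F s) ((t - s) • F'), Lp.coeFn_sub (F t) (F s),
    Lp.coeFn_smul (t - s) F', hF t, hF s, hF', hg, hg', hbound]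
    with x hsub_smul hsub hsmul hFt hFs hF's hgx hg'x hboundx
  rw [hsub_smul, Pi.sub_apply, hsub, Pi.sub_apply, hsmul, Pi.smul_apply, hFt, hFs, hF's]
  exact norm_sub_sub_smul_deriv_le hgx hg'x fun r hr => hboundx r (hr.trans ht)

end ParametricFunctions

/-! ### Variational equations -/

section VariationalEquations

open InnerProductSpace (toDual)

variable {Ω E V : Type*} [MeasurableSpace Ω] {μ : Measure Ω} [NormedAddCommGroup E]
  [InnerProductSpace ℝ E] [NormedAddCommGroup V] [InnerProductSpace ℝ V]

/-- Multiplication of square integrable functions by bounded ones. -/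
def smulL : Lp ℝ ⊤ μ →L[ℝ] Lp E 2 μ →L[ℝ] Lp E 2 μ :=
  (ContinuousLinearMap.lsmul ℝ ℝ : ℝ →L[ℝ] E →L[ℝ] E).holderL μ ⊤ 2 2

theorem coeFn_smulL (m : Lp ℝ ⊤ μ) (g : Lp E 2 μ) : smulL m g =ᵐ[μ] fun x => m x • g x :=
  ContinuousLinearMap.coeFn_holder (r := 2) _ m g

theorem norm_smulL_le (m : Lp ℝ ⊤ μ) : ‖(smulL m : Lp E 2 μ →L[ℝ] Lp E 2 μ)‖ ≤ ‖m‖ := by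
  refine ContinuousLinearMap.opNorm_le_bound _ (norm_nonneg _) fun g => ?_
  refine (ContinuousLinearMap.norm_holder_apply_apply_le (r := 2) _ m g).trans ?_
  refine mul_le_mul_of_nonneg_right (mul_le_of_le_one_left (norm_nonneg _) ?_) (norm_nonneg _)
  exact ContinuousLinearMap.opNorm_lsmul_le

theorem inner_smulL_ae_eq {m : Lp ℝ ⊤ μ} {κ : Ω → ℝ} (hm : m =ᵐ[μ] κ)
    (g h : Lp E 2 μ) :
    (fun x => inner ℝ (smulL m g x) (h x)) =ᵐ[μ] fun x => κ x * inner ℝ (g x) (h x) := by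
  filter_upwards [coeFn_smulL m g, hm] with x hsmul hmx
  rw [hsmul, hmx, real_inner_smul_left]

theorem integrable_mul_inner {m : Lp ℝ ⊤ μ} {κ : Ω → ℝ} (hm : m =ᵐ[μ] κ)
    (g h : Lp E 2 μ) :
    Integrable (fun x => κ x * inner ℝ (g x) (h x)) μ :=
  (L2.integrable_inner (smulL m g) h).congr (inner_smulL_ae_eq hm g h)

/-- `v` solves the variational equation `∫ κ ⟨G v, G w⟩ = f w` for all `w`, where `G` plays the role
of the gradient. As in `BoundedOpen.IsWeakSolution`, the integrals are required to exist. -/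
def IsVariationalSolution (G : V →ₗᵢ[ℝ] Lp E 2 μ) (κ : Ω → ℝ) (f : StrongDual ℝ V) (v : V) : Prop :=
  ∀ w, Integrable (fun x => κ x * inner ℝ (G v x) (G w x)) μ ∧
    ∫ x, κ x * inner ℝ (G v x) (G w x) ∂μ = f w

section BoundedCoefficients

variable [CompleteSpace E] [CompleteSpace V] (G : V →ₗᵢ[ℝ] Lp E 2 μ)

/-- The operator on `V` with quadratic form `∫ m ‖G v‖²`, as a function of the coefficient `m`. -/
def formOperator : Lp ℝ ⊤ μ →L[ℝ] V →L[ℝ] V :=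
  (ContinuousLinearMap.compL ℝ V (Lp E 2 μ) V
      (ContinuousLinearMap.adjoint G.toContinuousLinearMap)) ∘L
    ((ContinuousLinearMap.compL ℝ V (Lp E 2 μ) (Lp E 2 μ)).flip G.toContinuousLinearMap) ∘L smulL

theorem inner_formOperator_eq_inner_smulL (m : Lp ℝ ⊤ μ) (v w : V) :
    inner ℝ (formOperator G m v) w = inner ℝ (smulL m (G v)) (G w) :=
  ContinuousLinearMap.adjoint_inner_left G.toContinuousLinearMap w (smulL m (G v))

theorem norm_formOperator_le (m : Lp ℝ ⊤ μ) : ‖formOperator G m‖ ≤ ‖m‖ := by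
  refine ContinuousLinearMap.opNorm_le_bound _ (norm_nonneg _) fun v => ?_
  have hadjoint : ‖ContinuousLinearMap.adjoint G.toContinuousLinearMap‖ ≤ 1 := by
    rw [LinearIsometryEquiv.norm_map]
    exact G.norm_toContinuousLinearMap_le
  calc ‖formOperator G m v‖ ≤ 1 * ‖smulL m (G v)‖ :=
      ContinuousLinearMap.le_of_opNorm_le _ hadjoint (smulL m (G v))
    _ ≤ ‖m‖ * ‖v‖ := by
      rw [one_mul, ← G.norm_map v]
      exact ContinuousLinearMap.le_of_opNorm_le _ (norm_smulL_le m) (G v)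

variable {G} {m : Lp ℝ ⊤ μ} {κ : Ω → ℝ}

theorem inner_formOperator (hm : m =ᵐ[μ] κ) (v w : V) :
    inner ℝ (formOperator G m v) w = ∫ x, κ x * inner ℝ (G v x) (G w x) ∂μ := by
  rw [inner_formOperator_eq_inner_smulL, L2.inner_def]
  exact integral_congr_ae (inner_smulL_ae_eq hm (G v) (G w))

theorem formOperator_eq_one (hm : m =ᵐ[μ] 1) : formOperator G m = 1 := by
  ext1 v
  refine ext_inner_right ℝ fun w => ?_
  rw [inner_formOperator hm, one_apply_eq_self, ← G.inner_map_map v w, L2.inner_def]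
  simp only [Pi.one_apply, one_mul]

theorem isUnit_formOperator {k : ℝ} (hk : 0 < k) (hm : ∀ᵐ x ∂μ, k ≤ m x) :
    IsUnit (formOperator G m) := by
  refine ContinuousLinearMap.isUnit_of_forall_le_norm_inner_map _ (c := ⟨k, hk.le⟩) hk fun v => ?_
  calc ‖v‖ ^ 2 * k = ∫ x, k * inner ℝ (G v x) (G v x) ∂μ := by
        rw [integral_const_mul, ← L2.inner_def, G.inner_map_map, real_inner_self_eq_norm_sq,
          mul_comm]
    _ ≤ ∫ x, m x * inner ℝ (G v x) (G v x) ∂μ := by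
        refine integral_mono_ae ((L2.integrable_inner _ _).const_mul k)
          (integrable_mul_inner .rfl _ _) ?_
        filter_upwards [hm] with x hx
        exact mul_le_mul_of_nonneg_right hx real_inner_self_nonneg
    _ = inner ℝ (formOperator G m v) v := (inner_formOperator .rfl v v).symm
    _ ≤ ‖inner ℝ (formOperator G m v) v‖ := Real.le_norm_self _

theorem isVariationalSolution_iff (hm : m =ᵐ[μ] κ) {f : StrongDual ℝ V} {v : V} :
    IsVariationalSolution G κ f v ↔ formOperator G m v = (toDual ℝ V).symm f := by
  rw [ext_iff_inner_right ℝ]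
  simp only [inner_formOperator hm, InnerProductSpace.toDual_symm_apply]
  exact ⟨fun h w => (h w).2, fun h w => ⟨integrable_mul_inner hm _ _, h w⟩⟩

theorem existsUnique_isVariationalSolution (G : V →ₗᵢ[ℝ] Lp E 2 μ) (hκ : MemLp κ ⊤ μ) {k : ℝ}
    (hk : 0 < k) (hle : ∀ᵐ x ∂μ, k ≤ κ x) (f : StrongDual ℝ V) :
    ∃! v, IsVariationalSolution G κ f v := by
  have hunit : IsUnit (formOperator G (hκ.toLp κ)) := by
    refine isUnit_formOperator hk ?_
    filter_upwards [hκ.coeFn_toLp, hle] with x hx hlex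
    rwa [hx]
  simp only [isVariationalSolution_iff hκ.coeFn_toLp]
  exact (ContinuousLinearMap.isUnit_iff_bijective.1 hunit).existsUnique _

end BoundedCoefficients

section EnergySpace

variable (G : V →ₗᵢ[ℝ] Lp E 2 μ) (r : Lp ℝ ⊤ μ)

/-- For `r = κ₀^(-1/2)` this is the space of all `κ₀^(1/2) G v` in `L²`, so that its norm is the
energy norm of `v` for the coefficient `κ₀`. -/
def energySpace : Submodule ℝ (Lp E 2 μ) :=
  (LinearMap.range G.toLinearMap).comap (smulL r : Lp E 2 μ →L[ℝ] Lp E 2 μ).toLinearMap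

instance [CompleteSpace E] [CompleteSpace V] : CompleteSpace (energySpace G r) :=
  (G.isometry.isClosedEmbedding.isClosed_range.preimage (smulL r).continuous).completeSpace_coe

/-- The map `κ₀^(1/2) G v ↦ v`. -/
def ofEnergy : energySpace G r →L[ℝ] V :=
  G.equivRange.symm.toContinuousLinearEquiv.toContinuousLinearMap ∘L
    ((smulL r) ∘L (energySpace G r).subtypeL).codRestrict (LinearMap.range G.toLinearMap)
      fun g => g.2

variable {G r}

theorem apply_ofEnergy (g : energySpace G r) : G (ofEnergy G r g) = smulL r (g : Lp E 2 μ) :=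
  congrArg Subtype.val (G.equivRange.apply_symm_apply ⟨_, g.2⟩)

theorem norm_ofEnergy_le : ‖ofEnergy G r‖ ≤ ‖r‖ := by
  refine ContinuousLinearMap.opNorm_le_bound _ (norm_nonneg _) fun g => ?_
  rw [← G.norm_map, apply_ofEnergy]
  exact ContinuousLinearMap.le_of_opNorm_le _ (norm_smulL_le r) _

variable {κ κ₀ : Ω → ℝ}

theorem exists_ofEnergy_eq (hr : r =ᵐ[μ] fun x => (√(κ₀ x))⁻¹) (hκ₀ : ∀ᵐ x ∂μ, 0 < κ₀ x)
    (hmeas : AEStronglyMeasurable κ₀ μ) {v : V} (hv : Integrable (fun x => κ₀ x * ‖G v x‖ ^ 2) μ) :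
    ∃ g, ofEnergy G r g = v := by
  have hmem : MemLp (fun x => √(κ₀ x) • G v x) 2 μ := by
    refine (memLp_two_iff_integrable_sq_norm ((Real.continuous_sqrt.comp_aestronglyMeasurable
      hmeas).smul (Lp.aestronglyMeasurable _))).2 (hv.congr ?_)
    filter_upwards [hκ₀] with x hx
    rw [Pi.smul_apply', norm_smul, mul_pow, Real.norm_eq_abs, sq_abs, Real.sq_sqrt hx.le]
  have hsmul : smulL r hmem.toLp = G v := by
    refine Lp.ext ?_
    filter_upwards [hκ₀, hr, coeFn_smulL r hmem.toLp, hmem.coeFn_toLp] with x hx hrx hsmul hg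
    rw [hsmul, hg, hrx, smul_smul, inv_mul_cancel₀ (Real.sqrt_pos.2 hx).ne', one_smul]
  exact ⟨⟨hmem.toLp, v, hsmul.symm⟩, G.injective ((apply_ofEnergy _).trans hsmul)⟩

theorem div_mul_inner_ae_eq (hr : r =ᵐ[μ] fun x => (√(κ₀ x))⁻¹) (hκ₀ : ∀ᵐ x ∂μ, 0 < κ₀ x)
    (κ : Ω → ℝ) (g h : energySpace G r) :
    (fun x => κ x / κ₀ x * inner ℝ ((g : Lp E 2 μ) x) ((h : Lp E 2 μ) x)) =ᵐ[μ]
      fun x => κ x * inner ℝ (G (ofEnergy G r g) x) (G (ofEnergy G r h) x) := by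
  filter_upwards [hκ₀, hr, coeFn_smulL r (g : Lp E 2 μ), coeFn_smulL r (h : Lp E 2 μ)]
    with x hx hrx hg hh
  have hsq : (κ₀ x)⁻¹ = (√(κ₀ x))⁻¹ * (√(κ₀ x))⁻¹ := by
    rw [← mul_inv, Real.mul_self_sqrt hx.le]
  rw [apply_ofEnergy, apply_ofEnergy, hg, hh, hrx, real_inner_smul_left, real_inner_smul_right,
    div_eq_mul_inv, hsq]
  ring

theorem IsVariationalSolution.exists_ofEnergy {f : StrongDual ℝ V} {v : V}
    (hv : IsVariationalSolution G κ f v) (hr : r =ᵐ[μ] fun x => (√(κ₀ x))⁻¹)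
    (hκ₀ : ∀ᵐ x ∂μ, 0 < κ₀ x) (hmeas : AEStronglyMeasurable κ₀ μ) (hO : κ₀ =O[ae μ] κ) :
    ∃ g, ofEnergy G r g = v ∧ IsVariationalSolution (energySpace G r).subtypeₗᵢ
      (fun x => κ x / κ₀ x) (f ∘L ofEnergy G r) g := by
  have hfinite : Integrable (fun x => κ₀ x * ‖G v x‖ ^ 2) μ := by
    obtain ⟨K, hK⟩ := hO.bound
    refine ((hv v).1.norm.const_mul K).mono'
      (hmeas.mul ((Lp.aestronglyMeasurable _).norm.pow 2)) ?_
    filter_upwards [hK] with x hx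
    rw [real_inner_self_eq_norm_sq, norm_mul, norm_mul, ← mul_assoc]
    gcongr
  obtain ⟨g, rfl⟩ := exists_ofEnergy_eq hr hκ₀ hmeas hfinite
  refine ⟨g, rfl, fun h => ?_⟩
  have hae := div_mul_inner_ae_eq hr hκ₀ κ g h
  exact ⟨(hv _).1.congr hae.symm, (integral_congr_ae hae).trans (hv _).2⟩

end EnergySpace

end VariationalEquations

/-! ### The coefficient relative to a base point -/

theorem BoundedOpen.ae_mem {d : ℕ} (D : BoundedOpen d) : ∀ᵐ x ∂D.vol, x ∈ D.carrier :=
  ae_restrict_mem D.isOpen.measurableSet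

section Coefficient

variable {d : ℕ} {D : BoundedOpen d} {U : Set (ℕ → ℝ)}
  {a : EuclideanSpace ℝ (Fin d) → (ℕ → ℝ) → ℝ} {σ C : ℝ} {b : ℕ → ℝ}

/-- The parameters at which the coefficient is comparable to the one at `y₀`. Only there does
division by `a(·,y₀)` give bounded functions. -/
def comparableSet (D : BoundedOpen d) (U : Set (ℕ → ℝ))
    (a : EuclideanSpace ℝ (Fin d) → (ℕ → ℝ) → ℝ) (y₀ : ℕ → ℝ) : Set (ℕ → ℝ) :=
  {y ∈ U | (fun x => a x y) =Θ[ae D.vol] fun x => a x y₀}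

open Classical in
/-- `∂ᵛa(·,y) / a(·,y₀)` as an element of `L^∞(D)`, with value `0` if it is not bounded. -/
def relativePartial (D : BoundedOpen d) (a : EuclideanSpace ℝ (Fin d) → (ℕ → ℝ) → ℝ)
    (y₀ : ℕ → ℝ) (ν : ℕ →₀ ℕ) (y : ℕ → ℝ) : Lp ℝ ⊤ D.vol :=
  if h : MemLp (fun x => mixedPartial ν (a x) y / a x y₀) ⊤ D.vol then h.toLp else 0

theorem mem_comparableSet_self {y₀ : ℕ → ℝ} (hy₀ : y₀ ∈ U) : y₀ ∈ comparableSet D U a y₀ :=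
  ⟨hy₀, Asymptotics.isTheta_rfl⟩

namespace IsGevreyCoefficient

theorem gevreyBound_nonneg (hG : IsGevreyCoefficient D U a σ C b) (ν : ℕ →₀ ℕ) :
    0 ≤ gevreyBound σ C b ν :=
  _root_.gevreyBound_nonneg hG.C_pos.le hG.b_nonneg ν

theorem ae_abs_mixedPartial_le (hG : IsGevreyCoefficient D U a σ C b)
    (hpos : ∀ x ∈ D.carrier, ∀ y ∈ U, 0 < a x y) {y : ℕ → ℝ} (hy : y ∈ U) (ν : ℕ →₀ ℕ) :
    ∀ᵐ x ∂D.vol, |mixedPartial ν (a x) y| ≤ gevreyBound σ C b ν * a x y := by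
  have hnorm : _ ≤ ENNReal.ofReal (gevreyBound σ C b ν) := hG.bound y hy ν
  rw [eLpNorm_exponent_top] at hnorm
  filter_upwards [ae_le_eLpNormEssSup (f := fun x => mixedPartial ν (a x) y / a x y) (μ := D.vol),
    D.ae_mem] with x hx hxD
  have hquot := hx.trans hnorm
  rwa [← ofReal_norm, ENNReal.ofReal_le_ofReal_iff (hG.gevreyBound_nonneg ν), Real.norm_eq_abs,
    abs_div, abs_of_pos (hpos x hxD y hy), div_le_iff₀ (hpos x hxD y hy)] at hquot

theorem isBigO_mixedPartial (hG : IsGevreyCoefficient D U a σ C b)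
    (hpos : ∀ x ∈ D.carrier, ∀ y ∈ U, 0 < a x y) {y : ℕ → ℝ} (hy : y ∈ U) (ν : ℕ →₀ ℕ) :
    (fun x => mixedPartial ν (a x) y) =O[ae D.vol] fun x => a x y := by
  refine .of_bound (gevreyBound σ C b ν) ?_
  filter_upwards [hG.ae_abs_mixedPartial_le hpos hy ν, D.ae_mem] with x hx hxD
  rwa [Real.norm_eq_abs, Real.norm_of_nonneg (hpos x hxD y hy).le]

theorem aestronglyMeasurable_mixedPartial (hG : IsGevreyCoefficient D U a σ C b)
    (hU : IsUpdateClosed U) (ν : ℕ →₀ ℕ) :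
    ∀ y ∈ U, AEStronglyMeasurable (fun x => mixedPartial ν (a x) y) D.vol := by
  induction ν using multiIndex_induction with
  | zero =>
    simp only [mixedPartial_zero]
    exact hG.measurable
  | add_single ν j ih =>
    intro y hy
    exact aestronglyMeasurable_of_hasDerivAt (fun s => ih _ (hU y hy j s))
      (D.ae_mem.mono fun x hx => hG.smooth x hx ν y hy j)

theorem ae_forall_abs_mixedPartial_le (hG : IsGevreyCoefficient D U a σ C b)
    (hpos : ∀ x ∈ D.carrier, ∀ y ∈ U, 0 < a x y) (hU : IsUpdateClosed U) {y : ℕ → ℝ} (hy : y ∈ U)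
    (ν : ℕ →₀ ℕ) (j : ℕ) :
    ∀ᵐ x ∂D.vol, ∀ t, |mixedPartial ν (a x) (Function.update y j t)| ≤
      gevreyBound σ C b ν * a x (Function.update y j t) := by
  have hcont (μ : ℕ →₀ ℕ) :
      ∀ᵐ x ∂D.vol, Continuous fun t => mixedPartial μ (a x) (Function.update y j t) :=
    D.ae_mem.mono fun x hx => continuous_iff_continuousAt.2 fun t =>
      ((hG.smooth x hx).hasDerivAt_update hU hy μ j t).continuousAt
  refine ae_forall_le_of_forall_ae_le ((hcont ν).mono fun x hx => hx.abs)
    ((hcont 0).mono fun x hx => ?_) fun t => hG.ae_abs_mixedPartial_le hpos (hU y hy j t) ν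
  simpa only [mixedPartial_zero] using hx.const_mul (gevreyBound σ C b ν)

theorem ae_forall_le_exp_mul (hG : IsGevreyCoefficient D U a σ C b)
    (hpos : ∀ x ∈ D.carrier, ∀ y ∈ U, 0 < a x y) (hU : IsUpdateClosed U) {y : ℕ → ℝ} (hy : y ∈ U)
    (j : ℕ) :
    ∀ᵐ x ∂D.vol, ∀ s t, a x (Function.update y j t) ≤
      Real.exp (gevreyBound σ C b (single j 1) * |t - s|) * a x (Function.update y j s) := by
  filter_upwards [hG.ae_forall_abs_mixedPartial_le hpos hU hy (single j 1) j, D.ae_mem]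
    with x hx hxD s t
  refine le_exp_mul_of_abs_deriv_le (g := fun t => a x (Function.update y j t)) (fun t => ?_)
    (fun t => hpos x hxD _ (hU y hy j t)) hx s t
  simpa only [mixedPartial_zero, zero_add] using (hG.smooth x hxD).hasDerivAt_update hU hy 0 j t

theorem isBigO_update (hG : IsGevreyCoefficient D U a σ C b)
    (hpos : ∀ x ∈ D.carrier, ∀ y ∈ U, 0 < a x y) (hU : IsUpdateClosed U) {y : ℕ → ℝ} (hy : y ∈ U)
    (j : ℕ) (s t : ℝ) :
    (fun x => a x (Function.update y j t)) =O[ae D.vol] fun x => a x (Function.update y j s) := by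
  refine .of_bound (Real.exp (gevreyBound σ C b (single j 1) * |t - s|)) ?_
  filter_upwards [hG.ae_forall_le_exp_mul hpos hU hy j, D.ae_mem] with x hx hxD
  rw [Real.norm_of_nonneg (hpos x hxD _ (hU y hy j t)).le,
    Real.norm_of_nonneg (hpos x hxD _ (hU y hy j s)).le]
  exact hx s t

theorem isUpdateClosed_comparableSet (hG : IsGevreyCoefficient D U a σ C b)
    (hpos : ∀ x ∈ D.carrier, ∀ y ∈ U, 0 < a x y) (hU : IsUpdateClosed U) (y₀ : ℕ → ℝ) :
    IsUpdateClosed (comparableSet D U a y₀) := by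
  rintro y ⟨hy, hΘ⟩ j t
  have hO := hG.isBigO_update hpos hU hy j (y j) t
  have hO' := hG.isBigO_update hpos hU hy j t (y j)
  rw [Function.update_eq_self] at hO hO'
  exact ⟨hU y hy j t, .trans ⟨hO, hO'⟩ hΘ⟩

variable {y₀ y : ℕ → ℝ}

theorem coeFn_relativePartial (hG : IsGevreyCoefficient D U a σ C b)
    (hpos : ∀ x ∈ D.carrier, ∀ y ∈ U, 0 < a x y) (hU : IsUpdateClosed U) (hy₀ : y₀ ∈ U)
    (hy : y ∈ comparableSet D U a y₀) (ν : ℕ →₀ ℕ) :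
    relativePartial D a y₀ ν y =ᵐ[D.vol] fun x => mixedPartial ν (a x) y / a x y₀ := by
  have hmem : MemLp (fun x => mixedPartial ν (a x) y / a x y₀) ⊤ D.vol :=
    memLp_top_div (hG.aestronglyMeasurable_mixedPartial hU ν y hy.1) (hG.measurable y₀ hy₀)
      ((hG.isBigO_mixedPartial hpos hy.1 ν).trans hy.2.1)
  rw [relativePartial, dif_pos hmem]
  exact hmem.coeFn_toLp

theorem norm_relativePartial_self_le (hG : IsGevreyCoefficient D U a σ C b)
    (hpos : ∀ x ∈ D.carrier, ∀ y ∈ U, 0 < a x y) (hU : IsUpdateClosed U) (hy₀ : y₀ ∈ U)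
    (ν : ℕ →₀ ℕ) : ‖relativePartial D a y₀ ν y₀‖ ≤ gevreyBound σ C b ν := by
  refine norm_Lp_top_le (hG.gevreyBound_nonneg ν) ?_
  filter_upwards [hG.coeFn_relativePartial hpos hU hy₀ (mem_comparableSet_self hy₀) ν,
    hG.ae_abs_mixedPartial_le hpos hy₀ ν, D.ae_mem] with x hcoe hx hxD
  have hpos₀ := hpos x hxD y₀ hy₀
  rwa [hcoe, norm_div, Real.norm_eq_abs, Real.norm_of_nonneg hpos₀.le, div_le_iff₀ hpos₀]

theorem exists_ae_abs_relative_le (hG : IsGevreyCoefficient D U a σ C b)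
    (hpos : ∀ x ∈ D.carrier, ∀ y ∈ U, 0 < a x y) (hU : IsUpdateClosed U) (hy₀ : y₀ ∈ U)
    (hy : y ∈ comparableSet D U a y₀) (ν : ℕ →₀ ℕ) (j : ℕ) :
    ∃ M, 0 ≤ M ∧ ∀ᵐ x ∂D.vol, ∀ t, |t - y j| ≤ 1 →
      ‖mixedPartial ν (a x) (Function.update y j t) / a x y₀‖ ≤ M := by
  obtain ⟨K, hK, hcomparable⟩ := hy.2.1.exists_nonneg
  set k := gevreyBound σ C b (single j 1)
  set N := gevreyBound σ C b ν
  have hk : 0 ≤ k := hG.gevreyBound_nonneg _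
  have hN : 0 ≤ N := hG.gevreyBound_nonneg _
  refine ⟨N * (Real.exp k * K), by positivity, ?_⟩
  filter_upwards [hcomparable.bound, hG.ae_forall_le_exp_mul hpos hU hy.1 j,
    hG.ae_forall_abs_mixedPartial_le hpos hU hy.1 ν j, D.ae_mem] with x hyx hexp hpartial hxD t ht
  have hpos₀ := hpos x hxD y₀ hy₀
  rw [Real.norm_of_nonneg (hpos x hxD y hy.1).le, Real.norm_of_nonneg hpos₀.le] at hyx
  rw [norm_div, Real.norm_eq_abs, Real.norm_of_nonneg hpos₀.le, div_le_iff₀ hpos₀]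
  calc |mixedPartial ν (a x) (Function.update y j t)|
      ≤ N * a x (Function.update y j t) := hpartial t
    _ ≤ N * (Real.exp (k * |t - y j|) * a x y) := by
        gcongr
        simpa only [Function.update_eq_self] using hexp (y j) t
    _ ≤ N * (Real.exp k * (K * a x y₀)) := by
        gcongr
        · exact (hpos x hxD y hy.1).le
        · exact mul_le_of_le_one_right hk ht
    _ = N * (Real.exp k * K) * a x y₀ := by ring

theorem isPartialFamily_relativePartial (hG : IsGevreyCoefficient D U a σ C b)
    (hpos : ∀ x ∈ D.carrier, ∀ y ∈ U, 0 < a x y) (hU : IsUpdateClosed U) (hy₀ : y₀ ∈ U) :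
    IsPartialFamily (comparableSet D U a y₀) (relativePartial D a y₀ 0)
      (relativePartial D a y₀) where
  eqOn_zero := eqOn_refl _ _
  hasDerivAt ν y hy j := by
    have hderiv (μ : ℕ →₀ ℕ) : ∀ᵐ x ∂D.vol, ∀ t,
        HasDerivAt (fun t => mixedPartial μ (a x) (Function.update y j t) / a x y₀)
          (mixedPartial (μ + single j 1) (a x) (Function.update y j t) / a x y₀) t :=
      D.ae_mem.mono fun x hx t =>
        ((hG.smooth x hx).hasDerivAt_update hU hy.1 μ j t).div_const (a x y₀)
    obtain ⟨M, hM, hbound⟩ :=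
      hG.exists_ae_abs_relative_le hpos hU hy₀ hy (ν + single j 1 + single j 1) j
    refine hasDerivAt_Lp_top hM (fun t => hG.coeFn_relativePartial hpos hU hy₀
      (hG.isUpdateClosed_comparableSet hpos hU y₀ y hy j t) ν) ?_ (hderiv ν)
      (hderiv (ν + single j 1)) hbound
    simpa only [Function.update_eq_self] using
      hG.coeFn_relativePartial hpos hU hy₀ hy (ν + single j 1)

end IsGevreyCoefficient

end Coefficient

/-! ### The solution -/

namespace BoundedOpen

variable {d : ℕ} {D : BoundedOpen d}

namespace H10

instance : CompleteSpace D.H10 := by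
  let toPair : D.H10 →ₗ[ℝ] D.PairSpace := D.testPairs.topologicalClosure.subtype
  obtain ⟨R, hR₀, hR⟩ := D.isBounded.exists_pos_norm_le
  have hle (v : D.H10) : ‖toPair v‖ ≤ max (2 * R) 1 * ‖v‖ := by
    refine max_le ((D.norm_fst_le hR hR₀.le v.2).trans ?_)
      (le_mul_of_one_le_left (norm_nonneg _) (le_max_right _ _))
    exact mul_le_mul_of_nonneg_right (le_max_left _ _) (norm_nonneg _)
  have hge (v : D.H10) : ‖v‖ ≤ (1 : NNReal) * ‖toPair v‖ := by
    rw [NNReal.coe_one, one_mul]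
    exact le_max_right _ _
  have hinducing : IsUniformInducing toPair :=
    (AddMonoidHomClass.antilipschitz_of_bound toPair hge).isUniformInducing
      (AddMonoidHomClass.uniformContinuous_of_bound toPair _ hle)
  have hrange : range toPair = D.testPairs.topologicalClosure := Subtype.range_coe
  rw [completeSpace_iff_isComplete_range hinducing, hrange]
  exact D.testPairs.isClosed_topologicalClosure.isComplete

/-- The weak gradient as an isometry, by the choice of the norm of `H¹₀(D)`. -/
def gradₗᵢ : D.H10 →ₗᵢ[ℝ] Lp (EuclideanSpace ℝ (Fin d)) 2 D.vol := ⟨grad, fun _ => rfl⟩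

end H10

theorem isWeakSolution_iff {κ : EuclideanSpace ℝ (Fin d) → ℝ} {f : D.Hneg1} {w : D.H10} :
    D.IsWeakSolution κ f w ↔ IsVariationalSolution H10.gradₗᵢ κ f w :=
  Iff.rfl

end BoundedOpen

theorem IsPartialFamily.of_operator_equation {H V : Type*} [NormedAddCommGroup H] [NormedSpace ℝ H]
    [CompleteSpace H] [NormedAddCommGroup V] [NormedSpace ℝ V] {X : Set (ℕ → ℝ)}
    {S : (ℕ → ℝ) → H →L[ℝ] H} {T : (ℕ →₀ ℕ) → (ℕ → ℝ) → H →L[ℝ] H} (hT : IsPartialFamily X S T)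
    (hunit : ∀ y ∈ X, IsUnit (S y)) {J : H →L[ℝ] V} {F : H} {u : (ℕ → ℝ) → V}
    (hu : ∀ y ∈ X, ∃ g, J g = u y ∧ S y g = F) :
    IsPartialFamily X u fun ν y => J (inverseFamily T ν y F) := by
  refine ((hT.ringInverse hunit).clm_comp (J ∘L ContinuousLinearMap.apply ℝ H F)).congr
    fun y hy => ?_
  obtain ⟨g, hgu, hgF⟩ := hu y hy
  have hg : Ring.inverse (S y) F = g := by
    rw [← hgF, ← mul_apply_eq_comp, Ring.inverse_mul_cancel _ (hunit y hy),
      one_apply_eq_self]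
  exact (congrArg J hg).trans hgu

section Solution

open InnerProductSpace (toDual)
open BoundedOpen.H10 (gradₗᵢ)

variable {d : ℕ} {D : BoundedOpen d} {U : Set (ℕ → ℝ)}
  {a : EuclideanSpace ℝ (Fin d) → (ℕ → ℝ) → ℝ} {σ C : ℝ} {b : ℕ → ℝ}

/-- The derivatives of the operators of the problem in the energy space of `a(·,y₀)`. -/
def energyOperator (D : BoundedOpen d) (a : EuclideanSpace ℝ (Fin d) → (ℕ → ℝ) → ℝ)
    (r : Lp ℝ ⊤ D.vol) (y₀ : ℕ → ℝ) (ν : ℕ →₀ ℕ) (y : ℕ → ℝ) :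
    energySpace gradₗᵢ r →L[ℝ] energySpace gradₗᵢ r :=
  formOperator (energySpace gradₗᵢ r).subtypeₗᵢ (relativePartial D a y₀ ν y)

namespace IsGevreyCoefficient

variable {y₀ y : ℕ → ℝ} {r : Lp ℝ ⊤ D.vol}

theorem coeFn_relativePartial_zero (hG : IsGevreyCoefficient D U a σ C b)
    (hpos : ∀ x ∈ D.carrier, ∀ y ∈ U, 0 < a x y) (hU : IsUpdateClosed U) (hy₀ : y₀ ∈ U)
    (hy : y ∈ comparableSet D U a y₀) :
    relativePartial D a y₀ 0 y =ᵐ[D.vol] fun x => a x y / a x y₀ := by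
  simpa only [mixedPartial_zero] using hG.coeFn_relativePartial hpos hU hy₀ hy 0

theorem energyOperator_self (hG : IsGevreyCoefficient D U a σ C b)
    (hpos : ∀ x ∈ D.carrier, ∀ y ∈ U, 0 < a x y) (hU : IsUpdateClosed U) (hy₀ : y₀ ∈ U) :
    energyOperator D a r y₀ 0 y₀ = 1 := by
  refine formOperator_eq_one ?_
  filter_upwards [hG.coeFn_relativePartial_zero hpos hU hy₀ (mem_comparableSet_self hy₀),
    D.ae_mem] with x hx hxD
  rw [hx, div_self (hpos x hxD y₀ hy₀).ne', Pi.one_apply]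

theorem isPartialFamily_energyOperator (hG : IsGevreyCoefficient D U a σ C b)
    (hpos : ∀ x ∈ D.carrier, ∀ y ∈ U, 0 < a x y) (hU : IsUpdateClosed U) (hy₀ : y₀ ∈ U) :
    IsPartialFamily (comparableSet D U a y₀) (energyOperator D a r y₀ 0)
      (energyOperator D a r y₀) :=
  (hG.isPartialFamily_relativePartial hpos hU hy₀).clm_comp
    (F := energySpace gradₗᵢ r →L[ℝ] energySpace gradₗᵢ r) (formOperator _)

theorem isUnit_energyOperator (hG : IsGevreyCoefficient D U a σ C b)
    (hpos : ∀ x ∈ D.carrier, ∀ y ∈ U, 0 < a x y) (hU : IsUpdateClosed U) (hy₀ : y₀ ∈ U)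
    (hy : y ∈ comparableSet D U a y₀) : IsUnit (energyOperator D a r y₀ 0 y) := by
  obtain ⟨K, hK, hcomparable⟩ := hy.2.2.exists_pos
  refine isUnit_formOperator (inv_pos.2 hK) ?_
  filter_upwards [hcomparable.bound, hG.coeFn_relativePartial_zero hpos hU hy₀ hy, D.ae_mem]
    with x hx hrel hxD
  rwa [hrel, le_div_iff₀ (hpos x hxD y₀ hy₀), inv_mul_le_iff₀ hK,
    ← Real.norm_of_nonneg (hpos x hxD y₀ hy₀).le, ← Real.norm_of_nonneg (hpos x hxD y hy.1).le]

theorem exists_energyOperator_eq (hG : IsGevreyCoefficient D U a σ C b)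
    (hpos : ∀ x ∈ D.carrier, ∀ y ∈ U, 0 < a x y) (hU : IsUpdateClosed U) (hy₀ : y₀ ∈ U)
    (hr : r =ᵐ[D.vol] fun x => (√(a x y₀))⁻¹) (hy : y ∈ comparableSet D U a y₀) {f : D.Hneg1}
    {w : D.H10} (hw : D.IsWeakSolution (fun x => a x y) f w) :
    ∃ g, ofEnergy gradₗᵢ r g = w ∧
      energyOperator D a r y₀ 0 y g = (toDual ℝ _).symm (f ∘L ofEnergy gradₗᵢ r) := by
  obtain ⟨g, hgw, hg⟩ := (BoundedOpen.isWeakSolution_iff.1 hw).exists_ofEnergy hr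
    (D.ae_mem.mono fun x hx => hpos x hx y₀ hy₀) (hG.measurable y₀ hy₀) hy.2.2
  exact ⟨g, hgw, (isVariationalSolution_iff (hG.coeFn_relativePartial_zero hpos hU hy₀ hy)).1 hg⟩

theorem exists_isPartialFamily_solution (hG : IsGevreyCoefficient D U a σ C b)
    (hpos : ∀ x ∈ D.carrier, ∀ y ∈ U, 0 < a x y) (hU : IsUpdateClosed U) {f : D.Hneg1}
    {u : (ℕ → ℝ) → D.H10} (hu : ∀ y ∈ U, D.IsWeakSolution (fun x => a x y) f (u y)) (hy₀ : y₀ ∈ U)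
    {m : ℝ} (hm : 0 < m) (hlower : ∀ x ∈ D.carrier, m ≤ a x y₀) :
    ∃ W, IsPartialFamily (comparableSet D U a y₀) u W ∧
      ∀ ν, ‖W ν y₀‖ ≤ ‖f‖ / m * gevreyBound σ (gevreyFactor C ν.degree) b ν := by
  obtain ⟨r, hr, hr_norm⟩ :=
    exists_Lp_top_eq_inv_sqrt (hG.measurable y₀ hy₀) hm (D.ae_mem.mono hlower)
  set J := ofEnergy gradₗᵢ r
  set F := (toDual ℝ _).symm (f ∘L J)
  set T := energyOperator D a r y₀
  have hJF : ‖J‖ * ‖F‖ ≤ ‖f‖ / m := by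
    have hJ : ‖J‖ ≤ (√m)⁻¹ := norm_ofEnergy_le.trans hr_norm
    calc ‖J‖ * ‖F‖ ≤ ‖J‖ * (‖f‖ * ‖J‖) := by
          rw [LinearIsometryEquiv.norm_map]
          gcongr
          exact f.opNorm_comp_le J
      _ ≤ (√m)⁻¹ * (‖f‖ * (√m)⁻¹) := by gcongr
      _ = ‖f‖ / m := by
          rw [mul_left_comm, ← mul_inv, Real.mul_self_sqrt hm.le, div_eq_mul_inv]
  have hinverse (ν : ℕ →₀ ℕ) :
      ‖inverseFamily T ν y₀‖ ≤ gevreyBound σ (gevreyFactor C ν.degree) b ν :=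
    norm_inverseFamily_le hG.one_le_sigma hG.C_pos.le hG.b_nonneg ContinuousLinearMap.norm_id_le
      (hG.energyOperator_self hpos hU hy₀)
      (fun ν => (norm_formOperator_le _ _).trans (hG.norm_relativePartial_self_le hpos hU hy₀ ν)) ν
  refine ⟨_, (hG.isPartialFamily_energyOperator hpos hU hy₀).of_operator_equation
    (fun y hy => hG.isUnit_energyOperator hpos hU hy₀ hy)
    fun y hy => hG.exists_energyOperator_eq hpos hU hy₀ hr hy (hu y hy.1), fun ν => ?_⟩
  calc ‖J (inverseFamily T ν y₀ F)‖ ≤ ‖J‖ * (‖inverseFamily T ν y₀‖ * ‖F‖) :=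
        J.le_opNorm_of_le (ContinuousLinearMap.le_opNorm _ F)
    _ = ‖J‖ * ‖F‖ * ‖inverseFamily T ν y₀‖ := by ring
    _ ≤ ‖f‖ / m * gevreyBound σ (gevreyFactor C ν.degree) b ν := by
        gcongr
        exact hinverse ν

end IsGevreyCoefficient

end Solution

theorem isUpdateClosed_paramSet (α : ℕ → ℝ) (τ : ℝ) : IsUpdateClosed (paramSet α τ) := by
  intro y hy j t
  refine Summable.congr_cofinite (f := fun i => α i * |y i| ^ τ) hy ?_
  filter_upwards [(finite_singleton j).compl_mem_cofinite] with i hi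
  rw [Function.update_of_ne (by simpa using hi)]

theorem mainTheorem4_general {d : ℕ} (D : BoundedOpen d) {U : Set (ℕ → ℝ)} {σ C : ℝ} {b : ℕ → ℝ}
    {a : EuclideanSpace ℝ (Fin d) → (ℕ → ℝ) → ℝ} {m : (ℕ → ℝ) → ℝ} (f : D.Hneg1)
    (hG : IsGevreyCoefficient D U a σ C b) (hU : IsUpdateClosed U) (hm : ∀ y ∈ U, 0 < m y)
    (hlower : ∀ x ∈ D.carrier, ∀ y ∈ U, m y ≤ a x y) :
    (∀ y ∈ U, MemLp (fun x => a x y) ⊤ D.vol →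
      ∃! w : D.H10, D.IsWeakSolution (fun x => a x y) f w) ∧
    (∀ u : (ℕ → ℝ) → D.H10, (∀ y ∈ U, D.IsWeakSolution (fun x => a x y) f (u y)) →
      HasAllMixedPartials U u ∧
      ∀ ν : ℕ →₀ ℕ, ν ≠ 0 → ∀ y ∈ U,
        ‖mixedPartial ν u y‖ ≤ ‖f‖ / m y * (C * (C + 1) ^ (ν.degree - 1)) *
          (ν.degree.factorial : ℝ) ^ σ * multiPow b ν) := by
  have hpos (x) (hx : x ∈ D.carrier) (y) (hy : y ∈ U) : 0 < a x y :=
    (hm y hy).trans_le (hlower x hx y hy)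
  refine ⟨fun y hy hmem => ?_, fun u hu => ⟨fun ν y hy => ?_, fun ν hν y hy => ?_⟩⟩
  · exact existsUnique_isVariationalSolution BoundedOpen.H10.gradₗᵢ hmem (hm y hy)
      (D.ae_mem.mono fun x hx => hlower x hx y hy) f
  all_goals
    have hX := hG.isUpdateClosed_comparableSet hpos hU y
    have hyX : y ∈ comparableSet D U a y := mem_comparableSet_self hy
    obtain ⟨W, hW, hbound⟩ := hG.exists_isPartialFamily_solution hpos hU hu hy (hm y hy)
      fun x hx => hlower x hx y hy
  · exact hW.hasAllMixedPartials hX ν y hyX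
  · rw [hW.mixedPartial_eqOn hX ν hyX]
    refine (hbound ν).trans_eq ?_
    rw [gevreyBound, gevreyFactor, if_neg (mt (Finsupp.degree_eq_zero_iff ν).1 hν)]
    ring

end

theorem mainTheorem4 {d : ℕ} (D : BoundedOpen d) (β τ σ c C : ℝ) (α b : ℕ → ℝ)
    (a : EuclideanSpace ℝ (Fin d) → (ℕ → ℝ) → ℝ) (f : D.Hneg1)
    (hGevrey : IsGevreyCoefficient D (paramSet α τ) a σ C b)
    (hLower : IsLowerBounded D a c α τ β) :
    (∀ y ∈ paramSet α τ, MemLp (fun x => a x y) ⊤ D.vol →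
      ∃! w : D.H10, D.IsWeakSolution (fun x => a x y) f w) ∧
    (∀ u : (ℕ → ℝ) → D.H10,
      (∀ y ∈ paramSet α τ, D.IsWeakSolution (fun x => a x y) f (u y)) →
      HasAllMixedPartials (paramSet α τ) u ∧
      ∀ ν : ℕ →₀ ℕ, ν ≠ 0 → ∀ y ∈ paramSet α τ,
        ‖mixedPartial ν u y‖ ≤
          ‖f‖ / aMin c α τ y * (C * (C + 1) ^ (ν.degree - 1)) *
            (ν.degree.factorial : ℝ) ^ σ * multiPow b ν) :=
  mainTheorem4_general D f hGevrey (isUpdateClosed_paramSet α τ)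
    (fun _ _ => mul_pos hLower.c_pos (Real.exp_pos _)) hLower.lower
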